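/- **Setting.** On $\mathbb R^4$ let $\Omega(X,Y)={}^tXJY$, $J=\begin{pmatrix}0&I_2\\-I_2&0\end{pmatrix}$, and let $\mathcal S(4,\mathbb R)=\mathbb R^4\rtimes \mathrm{Sp}(4,\mathbb R)$ be the affine symplectic group, with elements $\mathbf S=(P,\mathbf X)$, $\mathbf X=(X_1,\dots,X_4)$. Let $\Lambda_2^+$ be the manifold of oriented Lagrangian planes of $\mathbb R^4$, a homogeneous space of $\mathrm{Sp}(4,\mathbb R)$ through $\mathbf X\mapsto[X_1\wedge X_2]$. For a map $\mathbf X$ into $\mathrm{Sp}(4,\mathbb R)$ write $\mathbf X^{-1}d\mathbf X=\begin{pmatrix}\alpha&\beta\\ \gamma&-{}^t\alpha\end{pmatrix}$, with upper index for the row and lower index for the column; $\Lambda_2^+$ carries the conformal structure of signature $(2,1)$ determined by $-\gamma^1_1\gamma^2_2+(\gamma^2_1)^2$. Let $U\subset\mathbb C$ be a simply connected domain with coordinate $z=x+iy$, oriented by $dx\wedge dy$. A smooth immersion $f:U\to\mathbb R^4$ with $f^*\Omega=0$ has the Gauss map $\mathcal T_f:U\to\Lambda_2^+$, where $\mathcal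 T_f(q)=df(T_qU)$ with the orientation opposite to the one induced by $f$; it is an *elliptic Lagrangian immersion* if $\mathcal T_f$ is a spacelike immersion. A smooth $\mathbf S=(f,\mathbf X):U\to\mathcal S(4,\mathbb R)$ is a *frame field along $f$ adapted to $(U,z)$* if $\mathcal T_f=[X_1\wedge X_2]$, $\gamma^1_1+\gamma^2_2=0$, $\omega:=\tfrac12(\gamma^1_1-\gamma^2_2)+i\gamma^2_1=dz$, $\alpha^1_1+\alpha^2_2=\alpha^2_1-\alpha^1_2=0$, and $\eta:=\tfrac12(\alpha^1_1-\alpha^2_2)-\tfrac i2(\alpha^2_1+\alpha^1_2)$ is of type $(1,0)$. With $df=\tau^jX_j$, $\tau:=\tau^1-i\tau^2$ and $\rho:=\tfrac12(\beta^1_1-\beta^2_2)-i\beta^2_1$, its *invariant functions* $t,h,p:U\to\mathbb C$ are defined by $\tau=t\,dz$, $\eta=h\,dz$, $\rho^{(1,0)}=p\,dz$. **Theorem 1.** Let $t,h,p:U\to\mathbb C$ be smooth functions, with $t$ nowhere zero, such that $$t_{\bar z}=\bar t\,h,\qquad p_{\bar z}=2h\,\bar h_z+(|h|^2)_z,\qquad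 \bar p\,h-p\,\bar h=h_{\bar z\bar z}-\bar h_{zz}.$$ Then there is an elliptic Lagrangian immersion $f:U\to\mathbb R^4$ together with a unique frame field $\mathbf S:U\to\mathcal S(4,\mathbb R)$ along $f$ adapted to $(U,z)$ whose invariant functions are $t,h,p$, and $f$ is unique up to affine symplectic transformation: every elliptic Lagrangian immersion of $U$ that has an adapted frame field with invariant functions $t,h,p$ is $g\circ f$ for some $g\in\mathcal S(4,\mathbb R)$. **Uniqueness.** More generally, if two elliptic Lagrangian immersions $f,\tilde f:U\to\mathbb R^4$ have frame fields adapted to $(U,z)$ with the same invariant functions, then $\tilde f=g\circ f$ for some $g\in\mathcal S(4,\mathbb R)$. -/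

import Mathlib

open scoped ContDiff Matrix

noncomputable section

namespace AffineSymplectic

/-! ### The symplectic space and the affine symplectic group -/

/-- The space `ℝ⁴ = ℝ² ⊕ ℝ²`; the coordinates `x¹, x², x³, x⁴` are
`x (inl 0), x (inl 1), x (inr 0), x (inr 1)`. -/
abbrev R4 : Type := Fin 2 ⊕ Fin 2 → ℝ

/-- Real `4 × 4` matrices, written in `2 × 2` blocks. -/
abbrev Mat4 : Type := Matrix (Fin 2 ⊕ Fin 2) (Fin 2 ⊕ Fin 2) ℝ

/-- The linear symplectic group `Sp(4, ℝ)`. -/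
abbrev Sp4 : Type := Matrix.symplecticGroup (Fin 2) ℝ

/-- The matrix `(0, I₂; -I₂, 0)`. -/
def stdJ : Mat4 := Matrix.fromBlocks 0 1 (-1) 0

/-- The standard symplectic form `Ω(X, Y) = ᵗX J Y`. -/
def Omega (x y : R4) : ℝ := x ⬝ᵥ (stdJ *ᵥ y)

/-- The affine symplectic group `ℝ⁴ ⋊ Sp(4, ℝ)`, with elements `S(P, X)`; these are also the affine
symplectic frames (a point `P` and the four columns of `X`). -/
@[ext] structure AffSp where
  /-- the point (translation part) -/
  P : R4
  /-- the linear part -/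
  X : Sp4

/-- The action of an affine symplectic transformation on `ℝ⁴`. -/
def AffSp.act (g : AffSp) (v : R4) : R4 := g.P + (g.X : Mat4) *ᵥ v

/-! ### Oriented Lagrangian planes -/

/-- An ordered pair of vectors of `ℝ⁴` (the columns of a `4 × 2` matrix) that is a basis of a
Lagrangian plane. -/
def IsLagrangianBasis (B : Matrix (Fin 2 ⊕ Fin 2) (Fin 2) ℝ) : Prop :=
  LinearIndependent ℝ B.col ∧ ∀ i j, Omega (B.col i) (B.col j) = 0

/-- Two bases give the same oriented plane if the base change has positive determinant. -/
def lagrangianBasisSetoid :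
    Setoid {B : Matrix (Fin 2 ⊕ Fin 2) (Fin 2) ℝ // IsLagrangianBasis B} where
  r B C := ∃ A : Matrix (Fin 2) (Fin 2) ℝ, 0 < A.det ∧ C.1 = B.1 * A
  iseqv :=
    { refl := fun B => ⟨1, by simp, by simp⟩
      symm := by
        rintro B C ⟨A, hA, h⟩
        refine ⟨A⁻¹, ?_, ?_⟩
        · rw [Matrix.det_nonsing_inv, Ring.inverse_eq_inv']
          exact inv_pos.mpr hA
        · rw [h, Matrix.mul_assoc, Matrix.mul_nonsing_inv A (isUnit_iff_ne_zero.mpr hA.ne'),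
            Matrix.mul_one]
      trans := by
        rintro B C D ⟨A, hA, h⟩ ⟨A', hA', h'⟩
        refine ⟨A * A', ?_, ?_⟩
        · rw [Matrix.det_mul]
          exact mul_pos hA hA'
        · rw [h', h, Matrix.mul_assoc] }

/-- The set `Λ₂⁺` of oriented Lagrangian planes of `ℝ⁴`. -/
def OrientedLagrangianPlane : Type := Quotient lagrangianBasisSetoid

/-- The oriented Lagrangian plane `[B₁ ∧ B₂]` with positive basis the columns of `B`. -/
def OrientedLagrangianPlane.mk (B : Matrix (Fin 2 ⊕ Fin 2) (Fin 2) ℝ) (hB : IsLagrangianBasis B) :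
    OrientedLagrangianPlane := Quotient.mk lagrangianBasisSetoid ⟨B, hB⟩

/-- The `4 × 2` matrix formed by the first two columns `X₁, X₂`. -/
def firstTwo (X : Mat4) : Matrix (Fin 2 ⊕ Fin 2) (Fin 2) ℝ := X.submatrix id Sum.inl

theorem isLagrangianBasis_firstTwo (X : Sp4) : IsLagrangianBasis (firstTwo X) := by
  constructor
  · have hu : IsUnit (X : Mat4) :=
      (Matrix.isUnit_iff_isUnit_det _).mpr (SymplecticGroup.symplectic_det X.2)
    have := Matrix.linearIndependent_cols_of_isUnit hu
    exact this.comp _ Sum.inl_injective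
  · intro i j
    have hX := SymplecticGroup.mem_iff'.mp X.2
    have h := congrFun (congrFun hX (Sum.inl i)) (Sum.inl j)
    have hJ : stdJ = - Matrix.J (Fin 2) ℝ := by
      simp [stdJ, Matrix.J, Matrix.fromBlocks_neg]
    have h0 : Matrix.J (Fin 2) ℝ (Sum.inl i) (Sum.inl j) = 0 := by simp [Matrix.J]
    rw [h0, Matrix.mul_assoc] at h
    rw [Omega, hJ, Matrix.neg_mulVec, dotProduct_neg, neg_eq_zero]
    exact h

/-- The projection `π_Λ : Sp(4, ℝ) → Λ₂⁺`, `X ↦ [X₁ ∧ X₂]`. -/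
def projLambda (X : Sp4) : OrientedLagrangianPlane :=
  OrientedLagrangianPlane.mk (firstTwo X) (isLagrangianBasis_firstTwo X)

/-! ### The Maurer-Cartan form along a map

Maps are defined on `ℂ` but only their restriction to an open set `U ⊆ ℂ` matters; a 1-form at `q`
is a function of the tangent vector `w : ℂ`. -/

/-- `X : U → Sp(4, ℝ)` is smooth. -/
def SmoothSp (U : Set ℂ) (X : ℂ → Sp4) : Prop :=
  ∀ i j, ContDiffOn ℝ ∞ (fun z => (X z : Mat4) i j) U

/-- The derivative `dX(w)` at `q`. -/
def dMat (X : ℂ → Sp4) (q w : ℂ) : Mat4 :=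
  Matrix.of fun i j => fderiv ℝ (fun z => (X z : Mat4) i j) q w

/-- `θ = X⁻¹ dX`, i.e. `dX_j = θ^i_j X_i`. -/
def theta (X : ℂ → Sp4) (q w : ℂ) : Mat4 := (X q : Mat4)⁻¹ * dMat X q w

/-- The block `α` of `θ = (α, β; γ, -ᵗα)`; the entry `α i j` is `α^i_j`. -/
def alpha (X : ℂ → Sp4) (q w : ℂ) : Matrix (Fin 2) (Fin 2) ℝ := (theta X q w).toBlocks₁₁

/-- The block `β` of `θ`. -/
def beta (X : ℂ → Sp4) (q w : ℂ) : Matrix (Fin 2) (Fin 2) ℝ := (theta X q w).toBlocks₁₂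

/-- The block `γ` of `θ`. -/
def gamma (X : ℂ → Sp4) (q w : ℂ) : Matrix (Fin 2) (Fin 2) ℝ := (theta X q w).toBlocks₂₁

/-- The quadratic form `g = -γ¹₁ γ²₂ + (γ²₁)²`. -/
def gForm (X : ℂ → Sp4) (q w : ℂ) : ℝ :=
  - (gamma X q w 0 0 * gamma X q w 1 1) + (gamma X q w 1 0) ^ 2

/-- The map `T : U → Λ₂⁺` is a spacelike immersion. The smooth structure of `Λ₂⁺` is that of the
homogeneous space of `Sp(4, ℝ)`: smooth maps are those with smooth local lifts `X` through `π_Λ`.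
The forms `γ` span the semibasic forms of `π_Λ`, so `dT(w) = 0` exactly if `γ(w) = 0`, and the
conformal structure of `Λ₂⁺` is the class (up to positive multiples) of `gForm`. -/
def IsSpacelikeImmersion (U : Set ℂ) (T : U → OrientedLagrangianPlane) : Prop :=
  ∀ q ∈ U, ∃ (V : Set ℂ) (X : ℂ → Sp4), IsOpen V ∧ q ∈ V ∧ SmoothSp V X ∧
    (∀ z : U, (z : ℂ) ∈ V → projLambda (X z) = T z) ∧
    (∀ w : ℂ, gamma X q w = 0 → w = 0) ∧
    (∀ w : ℂ, w ≠ 0 → 0 < gForm X q w)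

/-! ### Elliptic Lagrangian immersions -/

/-- `f : U → ℝ⁴` is a smooth Lagrangian immersion. -/
structure IsLagrangianImmersion (U : Set ℂ) (f : ℂ → R4) : Prop where
  smooth : ContDiffOn ℝ ∞ f U
  immersion : ∀ q ∈ U, Function.Injective (fderiv ℝ f q)
  lagrangian : ∀ q ∈ U, ∀ v w : ℂ, Omega (fderiv ℝ f q v) (fderiv ℝ f q w) = 0

/-- The pair `df(∂_y), df(∂_x)`. The domain is oriented by `dx ∧ dy`, so this is a positive basis of
the tangent plane for the orientation induced by `-df(dx ∧ dy)`. -/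
def tangentBasis (f : ℂ → R4) (q : ℂ) : Matrix (Fin 2 ⊕ Fin 2) (Fin 2) ℝ :=
  Matrix.of fun i j => fderiv ℝ f q (![Complex.I, 1] j) i

theorem isLagrangianBasis_tangentBasis {U : Set ℂ} {f : ℂ → R4} (hf : IsLagrangianImmersion U f)
    {q : ℂ} (hq : q ∈ U) : IsLagrangianBasis (tangentBasis f q) := by
  have hcol : ∀ j, (tangentBasis f q).col j = fderiv ℝ f q (![Complex.I, 1] j) := by
    intro j; ext i; rfl
  constructor
  · have h1 : LinearIndependent ℝ ![Complex.I, (1 : ℂ)] := by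
      rw [LinearIndependent.pair_iff]
      intro s t hst
      have hre := congrArg Complex.re hst
      have him := congrArg Complex.im hst
      simp at hre him
      exact ⟨him, hre⟩
    have h2 := h1.map' (fderiv ℝ f q).toLinearMap
      (LinearMap.ker_eq_bot.mpr (hf.immersion q hq))
    have h3 : (tangentBasis f q).col = (fderiv ℝ f q).toLinearMap ∘ ![Complex.I, (1 : ℂ)] := by
      funext j; exact hcol j
    rw [h3]; exact h2
  · intro i j
    rw [hcol, hcol]
    exact hf.lagrangian q hq _ _

/-- The symplectic Gauss map `𝒯_f : U → Λ₂⁺`. -/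
def gaussMap {U : Set ℂ} {f : ℂ → R4} (hf : IsLagrangianImmersion U f) (z : U) :
    OrientedLagrangianPlane :=
  OrientedLagrangianPlane.mk (tangentBasis f z) (isLagrangianBasis_tangentBasis hf z.2)

/-- A Lagrangian immersion is elliptic if its Gauss map is a spacelike immersion. -/
def IsEllipticLagrangianImmersion (U : Set ℂ) (f : ℂ → R4) : Prop :=
  ∃ hf : IsLagrangianImmersion U f, IsSpacelikeImmersion U (gaussMap hf)

/-! ### Frame fields -/

/-- `S : U → 𝒮(4, ℝ)` is a (smooth) symplectic frame field along `f`. -/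
structure IsFrameField (U : Set ℂ) (f : ℂ → R4) (S : ℂ → AffSp) : Prop where
  smooth_point : ContDiffOn ℝ ∞ (fun z => (S z).P) U
  smooth_linear : SmoothSp U (fun z => (S z).X)
  along : ∀ z ∈ U, (S z).P = f z

/-- The forms `τ^j`, defined by `dP = τ^j X_j`. -/
def tauVec (S : ℂ → AffSp) (q w : ℂ) : R4 :=
  ((S q).X : Mat4)⁻¹ *ᵥ fderiv ℝ (fun z => (S z).P) q w

/-- `τ = τ¹ - i τ²`. -/
def tauForm (S : ℂ → AffSp) (q w : ℂ) : ℂ :=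
  (tauVec S q w (Sum.inl 0) : ℂ) - Complex.I * (tauVec S q w (Sum.inl 1) : ℂ)

/-- `ω = ½ (γ¹₁ - γ²₂) + i γ²₁`. -/
def omegaForm (S : ℂ → AffSp) (q w : ℂ) : ℂ :=
  let c := gamma (fun z => (S z).X) q w
  (((c 0 0 - c 1 1) / 2 : ℝ) : ℂ) + Complex.I * (c 1 0 : ℂ)

/-- `η = ½ (α¹₁ - α²₂) - (i/2) (α²₁ + α¹₂)`. -/
def etaForm (S : ℂ → AffSp) (q w : ℂ) : ℂ :=
  let a := alpha (fun z => (S z).X) q w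
  (((a 0 0 - a 1 1) / 2 : ℝ) : ℂ) - Complex.I * (((a 1 0 + a 0 1) / 2 : ℝ) : ℂ)

/-- `ρ = ½ (β¹₁ - β²₂) - i β²₁`. -/
def rhoForm (S : ℂ → AffSp) (q w : ℂ) : ℂ :=
  let b := beta (fun z => (S z).X) q w
  (((b 0 0 - b 1 1) / 2 : ℝ) : ℂ) - Complex.I * (b 1 0 : ℂ)

/-- A first order frame field: `𝒯_f = [X₁ ∧ X₂]`. -/
def IsFirstOrder (U : Set ℂ) (f : ℂ → R4) (S : ℂ → AffSp) : Prop :=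
  IsFrameField U f S ∧
    ∃ hf : IsLagrangianImmersion U f, ∀ z : U, gaussMap hf z = projLambda (S z).X

/-- A second order frame field: `½ (γ¹₁ + γ²₂) = 0`. -/
def IsSecondOrder (U : Set ℂ) (f : ℂ → R4) (S : ℂ → AffSp) : Prop :=
  IsFirstOrder U f S ∧ ∀ q ∈ U, ∀ w : ℂ,
    (gamma (fun z => (S z).X) q w 0 0 + gamma (fun z => (S z).X) q w 1 1) / 2 = 0

/-- A third order frame field: in `η = h ω + ℓ ω̄` the coefficient `ℓ` vanishes. -/
def IsThirdOrder (U : Set ℂ) (f : ℂ → R4) (S : ℂ → AffSp) : Prop :=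
  IsSecondOrder U f S ∧ ∀ q ∈ U, ∃ c : ℂ, ∀ w : ℂ, etaForm S q w = c * omegaForm S q w

/-- A third order frame field adapted to `(U, z)`: `ω = dz` and `α¹₁ + α²₂ = α²₁ - α¹₂ = 0`. -/
def IsAdapted (U : Set ℂ) (f : ℂ → R4) (S : ℂ → AffSp) : Prop :=
  IsThirdOrder U f S ∧ ∀ q ∈ U, ∀ w : ℂ,
    omegaForm S q w = w ∧
    alpha (fun z => (S z).X) q w 0 0 + alpha (fun z => (S z).X) q w 1 1 = 0 ∧
    alpha (fun z => (S z).X) q w 1 0 - alpha (fun z => (S z).X) q w 0 1 = 0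

/-- The `(1,0)`-part of a complex-valued `ℝ`-linear form `φ = a dz + b dz̄`, i.e. `a dz`. -/
def part10 (φ : ℂ → ℂ) (w : ℂ) : ℂ := (φ 1 - Complex.I * φ Complex.I) / 2 * w

/-- The invariant functions of `S` are `t, h, p`: `τ = t dz`, `η = h dz`, `ρ^{(1,0)} = p dz`. -/
def HasInvariants (U : Set ℂ) (S : ℂ → AffSp) (t h p : ℂ → ℂ) : Prop :=
  ∀ q ∈ U, ∀ w : ℂ, tauForm S q w = t q * w ∧ etaForm S q w = h q * w ∧
    part10 (rhoForm S q) w = p q * w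

/-! ### The integrability equations -/

/-- The derivative `u_z = ½ (u_x - i u_y)`. -/
def wz (u : ℂ → ℂ) (q : ℂ) : ℂ := (fderiv ℝ u q 1 - Complex.I * fderiv ℝ u q Complex.I) / 2

/-- The derivative `u_{z̄} = ½ (u_x + i u_y)`. -/
def wzbar (u : ℂ → ℂ) (q : ℂ) : ℂ := (fderiv ℝ u q 1 + Complex.I * fderiv ℝ u q Complex.I) / 2

/-- The complex conjugate function. -/
def conjFun (u : ℂ → ℂ) (q : ℂ) : ℂ := (starRingEnd ℂ) (u q)

/-- The integrability equations `t_{z̄} = t̄ h`, `p_{z̄} = 2 h h̄_z + (|h|²)_z`,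
`p̄ h - p h̄ = h_{z̄z̄} - h̄_{zz}`. -/
structure IntegrabilityEquations (U : Set ℂ) (t h p : ℂ → ℂ) : Prop where
  t_eq : ∀ q ∈ U, wzbar t q = conjFun t q * h q
  p_eq : ∀ q ∈ U,
    wzbar p q = 2 * h q * wz (conjFun h) q + wz (fun z => ((‖h z‖ ^ 2 : ℝ) : ℂ)) q
  h_eq : ∀ q ∈ U, conjFun p q * h q - p q * conjFun h q =
    wzbar (wzbar h) q - wz (wz (conjFun h)) q

end AffineSymplectic

end

open AffineSymplectic

/-! The equation `dX = X θ` acts on each row of the frame matrix separately, and the coefficients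
are the same for every row. With `a = x¹ + i x²`, `b = x³ + i x⁴` and `f` the corresponding
coordinate of the point, an adapted frame with invariants `t, h, p` has rows that solve `da = conj
(h dz) conj a + dz conj b`, `db = conj (p dz + |h|² dz̄) conj a + 2 Re (h_z̄ dz) a - conj (h dz)
conj b`, `df = Re (a t dz)`. The adaptation conditions reduce `θ` to `η`, `ρ` and the trace of `β`.
Symmetry of the second derivative of `a` then fixes the `dz̄`-part of `ρ` and this trace
(`beta_eq`).

The curvature of the system vanishes by the three integrability equations (`isFlat_rowConnection`),
so on a simply connected `U` it has solutions with any initial value (`exists_parallel`). Starting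
from the rows of the identity matrix, the solutions form a symplectic matrix at every point, because
the symplectic pairing of two rows is constant (`fderiv_pairing`). This gives the frame and the
immersion.

For uniqueness, a constant affine symplectic map sends solutions to solutions. It is chosen to match
two frames at one point, and they then agree throughout the connected set `U` (`exists_congruence`).
Over a fixed `f` the frame is recovered algebraically: `df` gives `a` because `t ≠ 0`, and `da`
gives `b` (`eqOn_of_isAdapted`). -/

namespace FlatConnection

set_option maxSynthPendingDepth 3

open Set Metric Topology

variable {V E : Type*} [NormedAddCommGroup V] [NormedSpace ℝ V] [NormedAddCommGroup E]
  [NormedSpace ℝ E]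

/-! ### Linear total differential equations: uniqueness of solutions. -/

/-- `u` solves the linear total differential equation `du = A u` on `U`. -/
def IsParallel (A : V → V →L[ℝ] E →L[ℝ] E) (U : Set V) (u : V → E) : Prop :=
  ∀ z ∈ U, HasFDerivAt u ((A z).flip (u z)) z

/-- The curvature of the connection `d - A` vanishes on `U`. -/
def IsFlat (A : V → V →L[ℝ] E →L[ℝ] E) (U : Set V) : Prop :=
  ∀ z ∈ U, ∀ v w x, fderiv ℝ A z v w x + A z w (A z v x) = fderiv ℝ A z w v x + A z v (A z w x)

variable {A : V → V →L[ℝ] E →L[ℝ] E} {U D : Set V} {u u' : V → E}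

theorem IsParallel.mono (h : IsParallel A U u) (hD : D ⊆ U) : IsParallel A D u :=
  fun z hz => h z (hD hz)

theorem IsParallel.sub (h : IsParallel A U u) (h' : IsParallel A U u') :
    IsParallel A U (fun z => u z - u' z) := fun z hz => by
  simpa using (h z hz).fun_sub (h' z hz)

theorem IsParallel.add (h : IsParallel A U u) (h' : IsParallel A U u') :
    IsParallel A U (fun z => u z + u' z) := fun z hz => by
  simpa using (h z hz).fun_add (h' z hz)

theorem IsParallel.const_smul (h : IsParallel A U u) (c : ℝ) :
    IsParallel A U (fun z => c • u z) := fun z hz => by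
  simpa using (h z hz).fun_const_smul c

theorem IsParallel.sum {ι : Type*} (s : Finset ι) {u : ι → V → E}
    (h : ∀ i ∈ s, IsParallel A U (u i)) : IsParallel A U (fun z => ∑ i ∈ s, u i z) := fun z hz => by
  simpa using HasFDerivAt.fun_sum fun i hi => h i hi z hz

theorem hasDerivAt_segment (c x : V) (s : ℝ) : HasDerivAt (fun s : ℝ => c + s • x) x s := by
  simpa using ((hasDerivAt_id s).smul_const x).const_add c

theorem segment_mem (hD : Convex ℝ D) {c z : V} (hc : c ∈ D) (hz : z ∈ D) {s : ℝ}
    (hs : s ∈ Icc (0 : ℝ) 1) : c + s • (z - c) ∈ D :=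
  hD.add_smul_sub_mem hc hz hs

/-- A parallel section on a convex set vanishing at a point vanishes identically. -/
theorem IsParallel.eq_zero_of_convex (h : IsParallel A D u) (hD : Convex ℝ D) {M : ℝ}
    (hM : ∀ z ∈ D, ‖A z‖ ≤ M) {c : V} (hc : c ∈ D) (huc : u c = 0) {z : V} (hz : z ∈ D) :
    u z = 0 := by
  have hder : ∀ s ∈ Icc (0 : ℝ) 1, HasDerivAt (fun s : ℝ => u (c + s • (z - c)))
      (A (c + s • (z - c)) (z - c) (u (c + s • (z - c)))) s := fun s hs => by
    simpa [Function.comp_def] using (h _ (segment_mem hD hc hz hs)).comp_hasDerivAt s (hasDerivAt_segment c (z - c) s)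
  -- Along the segment from `c` to `z` the norm of the derivative is at most `M * ‖z - c‖` times the
  -- norm of the function, so Gronwall's inequality keeps the function at zero.
  have key := eq_zero_of_abs_deriv_le_mul_abs_self_of_eq_zero_right
    (f := fun s : ℝ => u (c + s • (z - c))) (K := M * ‖z - c‖) (a := 0) (b := 1)
    (fun s hs => (hder s hs).continuousAt.continuousWithinAt)
    (fun s hs => (hder s (Ico_subset_Icc_self hs)).hasDerivWithinAt) (by simpa using huc)
    (fun s hs => by
      refine ((A _ (z - c)).le_opNorm _).trans ?_
      gcongr
      refine ((A _).le_opNorm _).trans ?_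
      gcongr
      exact hM _ (segment_mem hD hc hz (Ico_subset_Icc_self hs)))
  simpa using key 1 (by simp)

theorem exists_ball_norm_le {z : V} (hA : ContinuousAt A z) :
    ∃ r > 0, ∀ y ∈ ball z r, ‖A y‖ ≤ ‖A z‖ + 1 := by
  have := (((continuous_norm (E := V →L[ℝ] E →L[ℝ] E)).tendsto (A z)).comp
    hA).eventually_le_const (lt_add_one ‖A z‖)
  obtain ⟨r, hr, h⟩ := Metric.eventually_nhds_iff_ball.mp this
  exact ⟨r, hr, h⟩

/-- Parallel sections on a preconnected open set are determined by their value at a point. -/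
theorem IsParallel.eqOn (h : IsParallel A U u) (h' : IsParallel A U u') (hU : IsOpen U)
    (hU' : IsPreconnected U) (hA : ContinuousOn A U) {c : V} (hc : c ∈ U) (huc : u c = u' c) :
    EqOn u u' U := by
  have hw := h.sub h'
  set w : V → E := fun z => u z - u' z
  have hloc : ∀ z ∈ U, ∃ r > 0, ball z r ⊆ U ∧
      ∀ y ∈ ball z r, w y = 0 → ∀ x ∈ ball z r, w x = 0 := by
    intro z hz
    obtain ⟨r₁, hr₁, hb⟩ := Metric.isOpen_iff.mp hU z hz
    obtain ⟨r₂, hr₂, hM⟩ := exists_ball_norm_le (hA.continuousAt (hU.mem_nhds hz))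
    have hs₁ : ball z (min r₁ r₂) ⊆ U := (ball_subset_ball (min_le_left _ _)).trans hb
    refine ⟨min r₁ r₂, lt_min hr₁ hr₂, hs₁, fun y hy hwy x hx => ?_⟩
    exact (hw.mono hs₁).eq_zero_of_convex (convex_ball _ _)
      (fun q hq => hM q (ball_subset_ball (min_le_right _ _) hq)) hy hwy hx
  -- Taking the set where the difference vanishes near the point makes openness automatic; `hloc`
  -- shows that it is closed in `U`.
  have hsub : U ⊆ {z | ∀ᶠ y in 𝓝 z, w y = 0} := by
    refine hU'.subset_of_closure_inter_subset isOpen_setOfPred_eventually_nhds ⟨c, hc, ?_⟩ ?_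
    · obtain ⟨r, hr, -, hz⟩ := hloc c hc
      filter_upwards [ball_mem_nhds c hr] with x hx
      exact hz c (mem_ball_self hr) (sub_eq_zero.mpr huc) x hx
    · rintro z ⟨hzc, hzU⟩
      obtain ⟨r, hr, -, hz⟩ := hloc z hzU
      obtain ⟨y, hy, hyb⟩ := Metric.mem_closure_iff.mp hzc r hr
      filter_upwards [ball_mem_nhds z hr] with x hx
      exact hz y (by rwa [mem_ball']) (show ∀ᶠ q in 𝓝 y, w q = 0 from hy).self_of_nhds x hx
  exact fun z hz => sub_eq_zero.mp (hsub hz).self_of_nhds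

/-! ### Local solvability by radial transport. -/

/-- The solution of the equation of parallel transport along a short segment. -/
theorem exists_transport_segment [CompleteSpace E] (hD : Convex ℝ D) {M : ℝ}
    (hM : ∀ z ∈ D, ‖A z‖ ≤ M) (hA : ContinuousOn A D) {c z : V} (hc : c ∈ D) (hz : z ∈ D)
    (hsmall : M * ‖z - c‖ ≤ 1 / 4) (e : E) :
    ∃ Y : ℝ → E, Y 0 = e ∧ ∀ s ∈ Icc (0 : ℝ) 1,
      HasDerivWithinAt Y (A (c + s • (z - c)) (z - c) (Y s)) (Icc 0 1) s := by
  have hop : ∀ s ∈ Icc (0 : ℝ) 1, ‖A (c + s • (z - c)) (z - c)‖ ≤ 1 / 4 := fun s hs =>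
    ((A _).le_opNorm _).trans ((mul_le_mul_of_nonneg_right
      (hM _ (segment_mem hD hc hz hs)) (norm_nonneg _)).trans hsmall)
  -- On the ball of radius `‖e‖` about `e` one has `‖x‖ ≤ 2 * ‖e‖`, so the field is bounded by `‖e‖
  -- / 2` and a solution cannot leave the ball in unit time. The bound `1 / 4` is also the Lipschitz
  -- constant.
  have hPL : IsPicardLindelof (fun s x => A (c + s • (z - c)) (z - c) x)
      (⟨0, by simp⟩ : Icc (0 : ℝ) 1) e ‖e‖₊ 0 (‖e‖₊ / 2) (1 / 4) := by
    refine ⟨fun s hs => ?_, fun x _ => ?_, fun s hs x hx => ?_, ?_⟩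
    · refine ((A (c + s • (z - c)) (z - c)).lipschitz.weaken ?_).lipschitzOnWith
      rw [← NNReal.coe_le_coe]
      simpa using hop s hs
    · have h1 : ContinuousOn (fun s : ℝ => A (c + s • (z - c))) (Icc 0 1) :=
        hA.comp (by fun_prop) fun s hs => segment_mem hD hc hz hs
      exact (h1.clm_apply continuousOn_const).clm_apply continuousOn_const
    · have hx' : ‖x‖ ≤ 2 * ‖e‖ := by
        have : ‖x - e‖ ≤ ‖e‖ := by simpa [dist_eq_norm] using hx
        linarith [norm_le_norm_add_norm_sub' x e]
      calc ‖A (c + s • (z - c)) (z - c) x‖ ≤ 1 / 4 * (2 * ‖e‖) :=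
            ((A _ _).le_opNorm x).trans (mul_le_mul (hop s hs) hx' (norm_nonneg _) (by norm_num))
        _ ≤ _ := by simp; linarith
    · simp
  obtain ⟨Y, h0, hY⟩ := hPL.exists_eq_forall_mem_Icc_hasDerivWithinAt₀
  exact ⟨Y, h0, hY⟩

theorem norm_apply_apply_le (L : V →L[ℝ] E →L[ℝ] E) (v : V) (x : E) {a b d : ℝ} (ha : ‖L‖ ≤ a)
    (hb : ‖v‖ ≤ b) (hd : ‖x‖ ≤ d) : ‖L v x‖ ≤ a * b * d := by
  have h1 := L.le_opNorm₂ v x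
  have ha' := (norm_nonneg L).trans ha
  have hb' := (norm_nonneg v).trans hb
  exact h1.trans (by gcongr)

/-- The difference of two radial transports, compared with its first order approximation. -/
theorem norm_transport_sub_le (hD : Convex ℝ D) (hDo : IsOpen D) {M K B : ℝ}
    (hM : ∀ z ∈ D, ‖A z‖ ≤ M) (hK : ∀ z ∈ D, ∀ y ∈ D, ‖A y - A z‖ ≤ K * ‖y - z‖)
    (hK' : ∀ z ∈ D, ∀ y ∈ D, ‖A y - A z - fderiv ℝ A z (y - z)‖ ≤ K * ‖y - z‖ ^ 2)
    (hdiff : DifferentiableOn ℝ A D) (hflat : IsFlat A D) (hK0 : 0 ≤ K) {c z y : V}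
    (hc : c ∈ D) (hz : z ∈ D) (hy : y ∈ D) (hsmall : M * ‖y - c‖ ≤ 1) {Y Y' : ℝ → E}
    (h0 : Y 0 = Y' 0) (hB : ∀ s ∈ Icc (0 : ℝ) 1, ‖Y s‖ ≤ B)
    (hY : ∀ s ∈ Icc (0 : ℝ) 1,
      HasDerivWithinAt Y (A (c + s • (z - c)) (z - c) (Y s)) (Icc 0 1) s)
    (hY' : ∀ s ∈ Icc (0 : ℝ) 1,
      HasDerivWithinAt Y' (A (c + s • (y - c)) (y - c) (Y' s)) (Icc 0 1) s) :
    ‖Y' 1 - Y 1 - A z (y - z) (Y 1)‖ ≤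
      (K * ‖z - c‖ * B + K * B + K * ‖z - c‖ * (M * B) + M * (M * B)) * (Real.exp 1 - 1)
        * ‖y - z‖ ^ 2 := by
  set x := z - c with hx
  set v := y - z with hv
  have hyc : y - c = x + v := by rw [hx, hv]; abel
  rw [hyc] at hY' hsmall
  have hp : ∀ s ∈ Icc (0 : ℝ) 1, c + s • x ∈ D := fun s hs => segment_mem hD hc hz hs
  have hp' : ∀ s ∈ Icc (0 : ℝ) 1, c + s • (x + v) ∈ D := fun s hs => by
    rw [← hyc]; exact segment_mem hD hc hy hs
  -- At time `s` the two segments are `s • v` apart, so the last term is the first order change of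
  -- the transport if the radial solution is parallel. Thus `F` is the error, and it starts at zero.
  set F : ℝ → E := fun s => Y' s - Y s - s • A (c + s • x) v (Y s) with hF
  set F' : ℝ → E := fun s => A (c + s • (x + v)) (x + v) (F s)
    + (A (c + s • (x + v)) - A (c + s • x) - fderiv ℝ A (c + s • x) (s • v)) x (Y s)
    + (A (c + s • (x + v)) - A (c + s • x)) v (Y s)
    + s • (A (c + s • (x + v)) - A (c + s • x)) x (A (c + s • x) v (Y s))
    + s • A (c + s • (x + v)) v (A (c + s • x) v (Y s)) with hF'
  have hder : ∀ s ∈ Icc (0 : ℝ) 1, HasDerivWithinAt F (F' s) (Icc 0 1) s := by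
    intro s hs
    have hAd : HasDerivWithinAt (fun s : ℝ => A (c + s • x)) (fderiv ℝ A (c + s • x) x)
        (Icc 0 1) s :=
      (HasFDerivAt.comp_hasDerivAt (l := A) s
        (hdiff.differentiableAt (hDo.mem_nhds (hp s hs))).hasFDerivAt
        (hasDerivAt_segment c x s)).hasDerivWithinAt
    have h1 := (hAd.clm_apply (hasDerivWithinAt_const s (Icc 0 1) v)).clm_apply (hY s hs)
    have h2 := ((hY' s hs).sub (hY s hs)).sub ((hasDerivWithinAt_id s (Icc 0 1)).smul h1)
    refine h2.congr_deriv ?_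
    -- Flatness trades the derivative of `A` along the segment, applied to `v`, for the derivative
    -- in direction `v`, applied to `x`. The terms linear in `v` then cancel, except those inside `A
    -- F`.
    have hfl := hflat _ (hp s hs) x v (Y s)
    have e1 : A (c + s • x) v (A (c + s • x) x (Y s)) = fderiv ℝ A (c + s • x) v x (Y s)
        + A (c + s • x) x (A (c + s • x) v (Y s)) - fderiv ℝ A (c + s • x) x v (Y s) := by
      rw [← hfl]; abel
    simp only [hF', hF, map_sub, map_add, map_smul, _root_.sub_apply,
      _root_.add_apply, _root_.smul_apply, e1, id, smul_sub, smul_add,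
      map_zero, add_zero, one_smul]
    abel
  have hv0 := norm_nonneg v
  have hx0 := norm_nonneg x
  have hB0 : 0 ≤ B := (norm_nonneg _).trans (hB 0 (by simp))
  have hM0 : 0 ≤ M := (norm_nonneg (A c)).trans (hM c hc)
  have hbound : ∀ s ∈ Icc (0 : ℝ) 1, ‖F' s‖ ≤ 1 * ‖F s‖
      + (K * ‖x‖ * B + K * B + K * ‖x‖ * (M * B) + M * (M * B)) * ‖v‖ ^ 2 := by
    intro s hs
    have hdiffp : c + s • (x + v) - (c + s • x) = s • v := by rw [smul_add]; abel
    have hsv : ‖s • v‖ ≤ ‖v‖ := by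
      rw [norm_smul, Real.norm_of_nonneg hs.1]
      exact mul_le_of_le_one_left hv0 hs.2
    have b1 : ‖A (c + s • (x + v)) - A (c + s • x)‖ ≤ K * ‖v‖ := by
      refine (hK _ (hp s hs) _ (hp' s hs)).trans ?_
      rw [hdiffp]; gcongr
    have b2 : ‖A (c + s • (x + v)) - A (c + s • x) - fderiv ℝ A (c + s • x) (s • v)‖
        ≤ K * ‖v‖ ^ 2 := by
      have := hK' _ (hp s hs) _ (hp' s hs)
      rw [hdiffp] at this
      refine this.trans ?_
      gcongr
    have b3 : ‖A (c + s • x) v (Y s)‖ ≤ M * ‖v‖ * B :=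
      norm_apply_apply_le _ _ _ (hM _ (hp s hs)) le_rfl (hB s hs)
    have hsm : ∀ e : E, ‖s • e‖ ≤ ‖e‖ := fun e => by
      rw [norm_smul, Real.norm_of_nonneg hs.1]
      exact mul_le_of_le_one_left (norm_nonneg _) hs.2
    have t1 : ‖A (c + s • (x + v)) (x + v) (F s)‖ ≤ 1 * ‖F s‖ := by
      refine (norm_apply_apply_le _ _ _ (hM _ (hp' s hs)) le_rfl le_rfl).trans ?_
      gcongr
    have t2 := norm_apply_apply_le _ x (Y s) b2 le_rfl (hB s hs)
    have t3 := norm_apply_apply_le _ v (Y s) b1 le_rfl (hB s hs)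
    have t4 := (hsm _).trans (norm_apply_apply_le _ x (A (c + s • x) v (Y s)) b1 le_rfl b3)
    have t5 := (hsm _).trans
      (norm_apply_apply_le _ v (A (c + s • x) v (Y s)) (hM _ (hp' s hs)) le_rfl b3)
    rw [hF']
    refine (norm_add_le_of_le (norm_add_le_of_le (norm_add_le_of_le (norm_add_le_of_le t1 t2) t3)
      t4) t5).trans (le_of_eq ?_)
    ring
  -- The growth constant is `1` because `M * ‖y - c‖ ≤ 1`, hence the factor `Real.exp 1 - 1`.
  have key := norm_le_gronwallBound_of_norm_deriv_right_le (f := F) (f' := F') (δ := 0) (K := 1)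
    (ε := (K * ‖x‖ * B + K * B + K * ‖x‖ * (M * B) + M * (M * B)) * ‖v‖ ^ 2) (a := 0) (b := 1)
    (fun s hs => (hder s hs).continuousWithinAt)
    (fun s hs => ((hder s (Ico_subset_Icc_self hs)).mono_of_mem_nhdsWithin
      (Icc_mem_nhdsGE_of_mem hs)))
    (by simp [hF, h0]) (fun s hs => hbound s (Ico_subset_Icc_self hs)) 1 (by simp)
  have hcz : c + x = z := by rw [hx]; abel
  simp only [hF, one_smul, hcz, gronwallBound_of_K_ne_0 one_ne_zero, sub_zero, mul_one, zero_mul,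
    zero_add, div_one] at key
  refine key.trans (le_of_eq ?_)
  ring

/-- Bootstrap: the derivative of `u` is `A` applied to `u`, so each degree of regularity of `u`
yields the next. -/
theorem IsParallel.contDiffOn (h : IsParallel A U u) (hU : IsOpen U) (hA : ContDiffOn ℝ ∞ A U) :
    ContDiffOn ℝ ∞ u U := by
  rw [contDiffOn_infty]
  intro n
  induction n with
  | zero => exact contDiffOn_zero.mpr fun z hz => (h z hz).continuousAt.continuousWithinAt
  | succ n ih =>
    push_cast
    rw [contDiffOn_succ_iff_fderiv_of_isOpen hU]
    refine ⟨fun z hz => (h z hz).differentiableAt.differentiableWithinAt,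
      fun h => absurd h (WithTop.coe_ne_top (a := (n : ℕ∞))), ?_⟩
    have hflip : ContDiffOn ℝ n (fun z => (A z).flip) U :=
      (ContinuousLinearMap.flipₗᵢ ℝ V E E).toContinuousLinearEquiv.contDiff.comp_contDiffOn
        (hA.of_le (by exact_mod_cast le_top))
    exact (hflip.clm_apply ih).congr fun z hz => (h z hz).fderiv

/-- The estimates on a small ball around a point at which `A` is of class `C²`. -/
theorem exists_ball_estimates {z₀ : V} (hU : IsOpen U) (hz₀ : z₀ ∈ U)
    (hA : ContDiffOn ℝ ∞ A U) :
    ∃ r > 0, ∃ M K : ℝ, 0 ≤ K ∧ ball z₀ r ⊆ U ∧ M * (2 * r) ≤ 1 / 4 ∧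
      (∀ z ∈ ball z₀ r, ‖A z‖ ≤ M) ∧
      (∀ z ∈ ball z₀ r, ∀ y ∈ ball z₀ r, ‖A y - A z‖ ≤ K * ‖y - z‖) ∧
      (∀ z ∈ ball z₀ r, ∀ y ∈ ball z₀ r,
        ‖A y - A z - fderiv ℝ A z (y - z)‖ ≤ K * ‖y - z‖ ^ 2) := by
  have hAt : ContDiffAt ℝ ∞ A z₀ := hA.contDiffAt (hU.mem_nhds hz₀)
  obtain ⟨K₁, t₁, ht₁, hL₁⟩ :=
    (hAt.of_le (m := 1) (by exact_mod_cast le_top)).exists_lipschitzOnWith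
  have hAd : ContDiffAt ℝ 1 (fderiv ℝ A) z₀ :=
    hAt.fderiv_right (m := 1) (WithTop.coe_le_coe.mpr (le_top : (1 + 1 : ℕ∞) ≤ ⊤))
  obtain ⟨K₂, t₂, ht₂, hL₂⟩ := hAd.exists_lipschitzOnWith
  obtain ⟨r₃, hr₃, hM⟩ := exists_ball_norm_le hAt.continuousAt
  obtain ⟨r₀, hr₀, hb⟩ := Metric.mem_nhds_iff.mp
    (Filter.inter_mem (Filter.inter_mem ht₁ ht₂) (hU.mem_nhds hz₀))
  set M := ‖A z₀‖ + 1 with hMdef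
  have hMpos : 0 < M := by positivity
  -- Two points of the ball are less than `2 * r` apart, so `r ≤ 1 / (8 * M)` gives the bound `1 /
  -- 4` needed for radial transport from any base point in the ball.
  set r := min (min r₀ r₃) (1 / (8 * M)) with hr
  have hrpos : 0 < r := by positivity
  have hsub : ball z₀ r ⊆ ball z₀ r₀ :=
    ball_subset_ball ((min_le_left _ _).trans (min_le_left _ _))
  refine ⟨r, hrpos, M, max K₁ K₂, by positivity, fun z hz => (hb (hsub hz)).2, ?_, ?_, ?_, ?_⟩
  · have : r ≤ 1 / (8 * M) := min_le_right _ _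
    calc M * (2 * r) ≤ M * (2 * (1 / (8 * M))) := by gcongr
      _ = 1 / 4 := by field_simp; norm_num
  · exact fun z hz => hM z (ball_subset_ball ((min_le_left _ _).trans (min_le_right _ _)) hz)
  · intro z hz y hy
    refine (hL₁.norm_sub_le (hb (hsub hy)).1.1 (hb (hsub hz)).1.1).trans ?_
    gcongr
    exact le_max_left _ _
  · intro z hz y hy
    have hseg : segment ℝ z y ⊆ ball z₀ r := (convex_ball z₀ r).segment_subset hz hy
    have := (convex_segment z y).norm_image_sub_le_of_norm_hasFDerivWithin_le' (𝕜 := ℝ)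
      (f := A) (f' := fderiv ℝ A) (φ := fderiv ℝ A z) (C := max K₁ K₂ * ‖y - z‖)
      (fun q hq => ((hA.differentiableOn (by simp)).differentiableAt
        (hU.mem_nhds (hb (hsub (hseg hq))).2)).hasFDerivAt.hasFDerivWithinAt)
      (fun q hq => by
        refine (hL₂.norm_sub_le (hb (hsub (hseg hq))).1.2 (hb (hsub hz)).1.2).trans ?_
        gcongr
        · exact le_max_right _ _
        · exact norm_sub_le_of_mem_segment hq)
      (left_mem_segment ℝ z y) (right_mem_segment ℝ z y)
    rwa [mul_assoc, ← sq] at this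

/-- Local solvability of a flat linear system. -/
theorem exists_ball_parallel [CompleteSpace E] {z₀ : V} (hU : IsOpen U) (hz₀ : z₀ ∈ U)
    (hA : ContDiffOn ℝ ∞ A U) (hflat : IsFlat A U) :
    ∃ r > 0, ball z₀ r ⊆ U ∧
      ∀ c ∈ ball z₀ r, ∀ e : E, ∃ u, IsParallel A (ball z₀ r) u ∧ u c = e := by
  obtain ⟨r, hr, M, K, hK0, hrU, hMr, hM, hK, hK'⟩ := exists_ball_estimates hU hz₀ hA
  refine ⟨r, hr, hrU, fun c hc e => ?_⟩
  have hM0 : 0 ≤ M := (norm_nonneg (A c)).trans (hM c hc)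
  have hsmall : ∀ z ∈ ball z₀ r, M * ‖z - c‖ ≤ 1 / 4 := fun z hz => by
    refine (mul_le_mul_of_nonneg_left ?_ hM0).trans hMr
    have h1 : dist z z₀ < r := hz
    have h2 : dist c z₀ < r := hc
    rw [← dist_eq_norm]
    linarith [dist_triangle_right z c z₀]
  choose! Y hY0 hY using fun z (hz : z ∈ ball z₀ r) =>
    exists_transport_segment (convex_ball z₀ r) hM (hA.continuousOn.mono hrU) hc hz (hsmall z hz) e
  refine ⟨fun z => Y z 1, fun z hz => ?_, ?_⟩
  · obtain ⟨B, hB⟩ := isCompact_Icc.exists_bound_of_continuousOn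
      (fun s hs => (hY z hz s hs).continuousWithinAt)
    have hest : ∀ y ∈ ball z₀ r, _ := fun y hy =>
      norm_transport_sub_le (convex_ball z₀ r) isOpen_ball hM hK hK'
        ((hA.differentiableOn (by simp)).mono hrU) (fun q hq => hflat q (hrU hq)) hK0 hc hz hy
        ((hsmall y hy).trans (by norm_num)) ((hY0 z hz).trans (hY0 y hy).symm) hB (hY z hz)
        (hY y hy)
    refine HasFDerivAt.of_isLittleO ?_
    have hO : (fun y => Y y 1 - Y z 1 - A z (y - z) (Y z 1)) =O[𝓝 z] fun y => ‖y - z‖ ^ 2 :=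
      Asymptotics.IsBigO.of_bound _ (by
        filter_upwards [isOpen_ball.mem_nhds hz] with y hy
        simpa using hest y hy)
    refine hO.trans_isLittleO ?_
    have h2 : (fun v : V => ‖v‖ ^ 2) =o[𝓝 0] fun v => v :=
      Asymptotics.isLittleO_norm_pow_id one_lt_two
    exact h2.comp_tendsto (tendsto_sub_nhds_zero_iff.mpr Filter.tendsto_id)
  -- At the base point the segment degenerates, so the transport is constant.
  · have hder : ∀ s ∈ Icc (0 : ℝ) 1, HasDerivWithinAt (Y c) 0 (Icc 0 1) s := fun s hs => by
      simpa using hY c hc s hs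
    have := constant_of_derivWithin_zero (f := Y c) (a := 0) (b := 1)
      (fun s hs => (hder s hs).differentiableWithinAt)
      (fun s hs => (hder s (Ico_subset_Icc_self hs)).derivWithin
        (uniqueDiffOn_Icc one_pos s (Ico_subset_Icc_self hs))) 1 (by simp)
    exact this.trans (hY0 c hc)

/-! ### From local to global solutions by a covering space. -/

/-- A space with its discrete topology. -/
@[ext] structure Discrete (E : Type*) where
  val : E

/-- The wrapper keeps this topology apart from the norm topology of `E`. -/
instance (E : Type*) : TopologicalSpace (Discrete E) := ⊥

instance (E : Type*) : DiscreteTopology (Discrete E) := ⟨rfl⟩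

/-- A family of balls on which the system has solutions `sol i q e` with value `e` at `q`. -/
structure LocalSolutions (A : V → V →L[ℝ] E →L[ℝ] E) (U : Set V) where
  r : U → ℝ
  r_pos : ∀ i, 0 < r i
  ball_subset : ∀ i : U, ball (i : V) (r i) ⊆ U
  sol : U → V → E → V → E
  parallel : ∀ i : U, ∀ q ∈ ball (i : V) (r i), ∀ e, IsParallel A (ball (i : V) (r i)) (sol i q e)
  sol_self : ∀ i : U, ∀ q ∈ ball (i : V) (r i), ∀ e, sol i q e q = e

namespace LocalSolutions

variable (L : LocalSolutions A U)

theorem mem_ball (i : U) : (i : V) ∈ ball (i : V) (L.r i) := mem_ball_self (L.r_pos i)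

/-- Two balls meet in a convex, hence connected, set. This is what makes the transition functions of
the bundle locally constant. -/
theorem eqOn_inter (hA : ContinuousOn A U) {i j : U} {v w : V → E}
    (hv : IsParallel A (ball (i : V) (L.r i)) v) (hw : IsParallel A (ball (j : V) (L.r j)) w)
    {q : V} (hi : q ∈ ball (i : V) (L.r i)) (hj : q ∈ ball (j : V) (L.r j)) (h : v q = w q) :
    EqOn v w (ball (i : V) (L.r i) ∩ ball (j : V) (L.r j)) :=
  (hv.mono inter_subset_left).eqOn (hw.mono inter_subset_right) (isOpen_ball.inter isOpen_ball)
    ((convex_ball _ _).inter (convex_ball _ _)).isPreconnected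
    (hA.mono (inter_subset_left.trans (L.ball_subset i))) ⟨hi, hj⟩ h

theorem sol_eq (hA : ContinuousOn A U) {i : U} {v : V → E}
    (hv : IsParallel A (ball (i : V) (L.r i)) v) {q p : V} (hq : q ∈ ball (i : V) (L.r i))
    (hp : p ∈ ball (i : V) (L.r i)) : L.sol i q (v q) p = v p :=
  L.eqOn_inter hA (L.parallel i q hq _) hv hq hq (L.sol_self i q hq _) ⟨hp, hp⟩

/-- The bundle with discrete fibre `E` whose continuous sections are the parallel sections. -/
def core (hA : ContinuousOn A U) : FiberBundleCore U U (Discrete E) where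
  baseSet i := Subtype.val ⁻¹' ball (i : V) (L.r i)
  isOpen_baseSet i := isOpen_ball.preimage continuous_subtype_val
  indexAt i := i
  mem_baseSet_at i := L.mem_ball i
  -- The coordinate of a local solution in the chart `i` is its value at the centre `i`. To change
  -- charts, the solution is evaluated at `q`, continued by the solution on ball `j`, and read at
  -- the centre `j`.
  coordChange i j q e := ⟨L.sol j q (L.sol i i e.val q) j⟩
  coordChange_self i q hq e := by
    ext
    change L.sol i q (L.sol i i e.val q) i = e.val
    rw [L.sol_eq hA (L.parallel i i (L.mem_ball i) e.val) hq (L.mem_ball i),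
      L.sol_self i i (L.mem_ball i)]
  continuousOn_coordChange i j := by
    rintro ⟨q, e⟩ ⟨⟨hi, hj⟩, -⟩
    have h1 : ∀ᶠ p : U in 𝓝 q, (p : V) ∈ ball (i : V) (L.r i) ∩ ball (j : V) (L.r j) :=
      (continuous_subtype_val.tendsto q).eventually
        ((isOpen_ball.inter isOpen_ball).mem_nhds ⟨hi, hj⟩)
    have h2 : ∀ᶠ x : Discrete E in 𝓝 e, x = e := by simp
    refine (continuousAt_const (y := (⟨L.sol j q (L.sol i i e.val q) j⟩ : Discrete E))).congr ?_
      |>.continuousWithinAt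
    rw [nhds_prod_eq]
    filter_upwards [h1.prod_mk h2] with p hp
    obtain ⟨p, x⟩ := p
    obtain ⟨⟨hpi, hpj⟩, rfl⟩ := hp
    have h := L.eqOn_inter hA (L.parallel i i (L.mem_ball i) x.val)
      (L.parallel j q hj (L.sol i i x.val q)) hi hj (L.sol_self j q hj _).symm ⟨hpi, hpj⟩
    ext
    change L.sol j q (L.sol i i x.val q) j = L.sol j p (L.sol i i x.val p) j
    rw [h, L.sol_eq hA (L.parallel j q hj _) hpj (L.mem_ball j)]
  coordChange_comp i j k q hq e := by
    ext
    change L.sol k q (L.sol j j (L.sol j q (L.sol i i e.val q) j) q) k =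
      L.sol k q (L.sol i i e.val q) k
    rw [L.sol_eq hA (L.parallel j q hq.1.2 _) (L.mem_ball j) hq.1.2, L.sol_self j q hq.1.2]

end LocalSolutions

/-- A flat linear system on a simply connected open set has a solution with any initial value. -/
theorem exists_parallel [CompleteSpace E] (hU : IsOpen U) (hsc : IsSimplyConnected U)
    (hA : ContDiffOn ℝ ∞ A U) (hflat : IsFlat A U) {c : V} (hc : c ∈ U) (e : E) :
    ∃ u, IsParallel A U u ∧ u c = e := by
  choose r hr hrU hsol using fun i : U => exists_ball_parallel hU i.2 hA hflat
  choose! sol hpar hself using hsol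
  let L : LocalSolutions A U := ⟨r, hr, hrU, sol, hpar, hself⟩
  let Z := L.core hA.continuousOn
  -- Since the fibre is discrete, the bundle is a covering, and the identity of the simply connected
  -- `U` lifts to a global section through the prescribed initial value.
  have cov : IsCoveringMap Z.proj := FiberBundle.isCoveringMap (F := Discrete E) (E := Z.Fiber)
  have := hsc.simplyConnectedSpace
  have : LocallyPathConnectedSpace U := hU.locallyPathConnectedSpace
  obtain ⟨s, ⟨hs₀, hs⟩, -⟩ := cov.existsUnique_continuousMap_lifts (ContinuousMap.id U) ⟨c, hc⟩
    (⟨⟨c, hc⟩, (⟨e⟩ : Discrete E)⟩ : Z.TotalSpace) rfl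
  have hproj : ∀ q : U, (s q).proj = q := fun q => congrFun hs q
  -- The fibre over `q` is coordinatized by the chart centred at `q`, so this is the value of the
  -- solution at `q` itself.
  let w : U → E := fun q => ((s q).snd : Discrete E).val
  have hw : ∀ i : U, ∀ᶠ q : U in 𝓝 i, w q = sol i i (w i) q := by
    intro i
    have hmem : s i ∈ (Z.localTriv i).source := by
      rw [Bundle.Trivialization.mem_source]
      change (s i).proj ∈ _
      rw [hproj]
      exact mem_ball_self (hr i)
    have hcont : ContinuousAt (fun q => (Z.localTriv i (s q)).2) i :=
      ContinuousAt.snd (((Z.localTriv i).continuousAt hmem).comp s.continuous.continuousAt)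
    have htriv : ∀ q : U, (Z.localTriv i (s q)).2 = ⟨sol i q (sol q q (w q) q) i⟩ := by
      intro q
      rw [Z.localTriv_apply]
      change Z.coordChange (s q).proj i (s q).proj (s q).snd = _
      rw [hproj q]
      rfl
    -- A continuous map into a discrete space is locally constant: near `i` the section follows a
    -- single local solution.
    have hconst : ∀ᶠ q in 𝓝 i, (Z.localTriv i (s q)).2 = (Z.localTriv i (s i)).2 := by
      have := hcont.tendsto
      rw [nhds_discrete (Discrete E), Filter.tendsto_pure] at this
      exact this
    have hb : ∀ᶠ q : U in 𝓝 i, (q : V) ∈ ball (i : V) (r i) :=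
      (continuous_subtype_val.tendsto i).eventually (ball_mem_nhds _ (hr i))
    filter_upwards [hconst, hb] with q hq hqb
    rw [htriv, htriv, hself q q (mem_ball_self (hr q)), hself i i (mem_ball_self (hr i)),
      hself i i (mem_ball_self (hr i)), Discrete.mk.injEq] at hq
    have := L.sol_eq hA.continuousOn (hpar i q hqb (w q)) (mem_ball_self (hr i)) hqb
    rw [hq, hself i q hqb] at this
    exact this.symm
  refine ⟨fun z => open Classical in if h : z ∈ U then w ⟨z, h⟩ else 0, fun z hz => ?_, ?_⟩
  · have := hpar ⟨z, hz⟩ z (mem_ball_self (hr _)) (w ⟨z, hz⟩) z (mem_ball_self (hr _))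
    rw [hself _ _ (mem_ball_self (hr _))] at this
    simp only [hz, dite_true]
    refine this.congr_of_eventuallyEq ?_
    have h2 := hw ⟨z, hz⟩
    rw [nhds_subtype_eq_comap_nhdsWithin, hU.nhdsWithin_eq hz, Filter.eventually_comap] at h2
    filter_upwards [h2, hU.mem_nhds hz] with q hq hqU
    simp only [hqU, dite_true]
    exact hq ⟨q, hqU⟩ rfl
  · simp only [hc, dite_true, w]
    have : s ⟨c, hc⟩ = ⟨⟨c, hc⟩, (⟨e⟩ : Discrete E)⟩ := hs₀
    rw [this]

end FlatConnection

namespace AffineSymplectic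

set_option maxSynthPendingDepth 3

open Set Topology FlatConnection
open scoped ComplexConjugate

/-! ### Wirtinger derivatives -/

theorem fderiv_eq_wz_add_wzbar (u : ℂ → ℂ) (q v : ℂ) :
    fderiv ℝ u q v = wz u q * v + wzbar u q * conj v := by
  have hL : fderiv ℝ u q v = v.re * fderiv ℝ u q 1 + v.im * fderiv ℝ u q Complex.I := by
    have hv : v = v.re • (1 : ℂ) + v.im • Complex.I := by simp [Complex.re_add_im]
    have h := congrArg (fderiv ℝ u q) hv
    rw [map_add, map_smul, map_smul] at h
    simpa only [Complex.real_smul] using h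
  have hc : v = v.re + v.im * Complex.I := (Complex.re_add_im v).symm
  have hc' : conj v = v.re - v.im * Complex.I := by
    apply Complex.ext <;> simp
  rw [hL, hc', wz, wzbar]
  conv_rhs => enter [1, 2]; rw [hc]
  linear_combination (v.im * fderiv ℝ u q Complex.I) * Complex.I_sq

theorem fderiv_conjFun {u : ℂ → ℂ} {q : ℂ} (hu : DifferentiableAt ℝ u q) (v : ℂ) :
    fderiv ℝ (conjFun u) q v = conj (fderiv ℝ u q v) := by
  have := (Complex.conjCLE : ℂ →L[ℝ] ℂ).hasFDerivAt.comp q hu.hasFDerivAt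
  exact congrArg (fun L : ℂ →L[ℝ] ℂ => L v) this.fderiv

theorem wz_conjFun {u : ℂ → ℂ} {q : ℂ} (hu : DifferentiableAt ℝ u q) :
    wz (conjFun u) q = conj (wzbar u q) := by
  rw [wz, wzbar, fderiv_conjFun hu, fderiv_conjFun hu]
  rw [map_div₀, map_add, map_mul, Complex.conj_I, map_ofNat]
  ring

theorem wz_congr {u v : ℂ → ℂ} {q : ℂ} (h : u =ᶠ[𝓝 q] v) : wz u q = wz v q := by
  rw [wz, wz, h.fderiv_eq]

theorem wz_normSq {u : ℂ → ℂ} {q : ℂ} (hu : DifferentiableAt ℝ u q) :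
    wz (fun z => ((‖u z‖ ^ 2 : ℝ) : ℂ)) q = wz u q * conj (u q) + u q * conj (wzbar u q) := by
  have he : (fun z => ((‖u z‖ ^ 2 : ℝ) : ℂ)) = fun z => u z * conjFun u z := by
    funext z
    rw [conjFun, Complex.mul_conj, Complex.normSq_eq_norm_sq]
  have hc : DifferentiableAt ℝ (conjFun u) q :=
    (Complex.conjCLE : ℂ →L[ℝ] ℂ).differentiableAt.comp q hu
  rw [he, ← wz_conjFun hu, wz, wz, wz, fderiv_fun_mul hu hc]
  simp [conjFun]
  ring

theorem contDiffOn_conj {u : ℂ → ℂ} {U : Set ℂ} (hu : ContDiffOn ℝ ∞ u U) :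
    ContDiffOn ℝ ∞ (fun z => conj (u z)) U :=
  (Complex.conjCLE : ℂ →L[ℝ] ℂ).contDiff.comp_contDiffOn hu

theorem contDiffOn_fderiv_apply {F : Type*} [NormedAddCommGroup F] [NormedSpace ℝ F] {u : ℂ → F}
    {U : Set ℂ} (hU : IsOpen U) (hu : ContDiffOn ℝ ∞ u U) (v : ℂ) :
    ContDiffOn ℝ ∞ (fun z => fderiv ℝ u z v) U :=
  (((contDiffOn_infty_iff_fderiv_of_isOpen hU).mp hu).2).clm_apply contDiffOn_const

theorem contDiffOn_wzbar {u : ℂ → ℂ} {U : Set ℂ} (hU : IsOpen U) (hu : ContDiffOn ℝ ∞ u U) :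
    ContDiffOn ℝ ∞ (wzbar u) U :=
  ((contDiffOn_fderiv_apply hU hu 1).add
    (contDiffOn_const.mul (contDiffOn_fderiv_apply hU hu Complex.I))).div_const 2

/-! ### The linear system of the rows of an adapted frame -/

/-- The state of one row of a frame: `x¹ + i x²`, `x³ + i x⁴` and the coordinate of the point. -/
abbrev RowSpace : Type := ℂ × ℂ × ℝ

/-- The differential of `x¹ + i x²`. -/
def rowUpper (h w a b : ℂ) : ℂ := conj (h * w) * conj a + w * conj b

/-- The differential of `x³ + i x⁴`. -/
def rowLower (h p k w a b : ℂ) : ℂ :=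
  conj (p * w + h * conj h * conj w) * conj a + (k * w + conj (k * w)) * a - conj (h * w) * conj b

/-- The differential of the coordinate of the point. -/
def rowPoint (t w a : ℂ) : ℝ := (a * t * w).re

/-- The linear system of the rows, as a bilinear map. -/
noncomputable def rowBilin (t h p k : ℂ) : ℂ →L[ℝ] RowSpace →L[ℝ] RowSpace :=
  (LinearMap.mk₂ ℝ (fun (w : ℂ) (x : RowSpace) =>
    ((rowUpper h w x.1 x.2.1, rowLower h p k w x.1 x.2.1, rowPoint t w x.1) : RowSpace))
    (by intros; ext <;> simp [rowUpper, rowLower, rowPoint] <;> ring)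
    (by intros; ext <;> simp [rowUpper, rowLower, rowPoint] <;> ring)
    (by intros; ext <;> simp [rowUpper, rowLower, rowPoint] <;> ring)
    (by intros; ext <;> simp [rowUpper, rowLower, rowPoint] <;> ring)).toContinuousBilinearMap

@[simp] theorem rowBilin_apply (t h p k w : ℂ) (x : RowSpace) :
    rowBilin t h p k w x =
      (rowUpper h w x.1 x.2.1, rowLower h p k w x.1 x.2.1, rowPoint t w x.1) := rfl

/-- The connection whose parallel sections are the rows of adapted frames. -/
noncomputable def rowConnection (t h p : ℂ → ℂ) (z : ℂ) : ℂ →L[ℝ] RowSpace →L[ℝ] RowSpace :=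
  rowBilin (t z) (h z) (p z) (wzbar h z)

variable {U : Set ℂ} {t h p : ℂ → ℂ}

theorem contDiffOn_rowConnection (hU : IsOpen U) (ht : ContDiffOn ℝ ∞ t U)
    (hh : ContDiffOn ℝ ∞ h U) (hp : ContDiffOn ℝ ∞ p U) :
    ContDiffOn ℝ ∞ (rowConnection t h p) U := by
  have hk := contDiffOn_wzbar hU hh
  refine contDiffOn_clm_apply.mpr fun w => contDiffOn_clm_apply.mpr fun x => ?_
  simp only [rowConnection, rowBilin_apply]
  have hhw := contDiffOn_conj (hh.mul (contDiffOn_const (c := w)))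
  have hkw := hk.mul (contDiffOn_const (c := w))
  refine ContDiffOn.prodMk ?_ (ContDiffOn.prodMk ?_ ?_)
  · exact (hhw.mul contDiffOn_const).add contDiffOn_const
  · refine ((ContDiffOn.mul ?_ contDiffOn_const).add
      ((hkw.add (contDiffOn_conj hkw)).mul contDiffOn_const)).sub (hhw.mul contDiffOn_const)
    exact contDiffOn_conj ((hp.mul contDiffOn_const).add
      ((hh.mul (contDiffOn_conj hh)).mul contDiffOn_const))
  · exact Complex.reCLM.contDiff.comp_contDiffOn ((contDiffOn_const.mul ht).mul contDiffOn_const)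

theorem hasDerivAt_line {F : Type*} [NormedAddCommGroup F] [NormedSpace ℝ F] {u : ℂ → F} {z : ℂ}
    (hu : DifferentiableAt ℝ u z) (v : ℂ) :
    HasDerivAt (fun s : ℝ => u (z + s • v)) (fderiv ℝ u z v) 0 := by
  have h0 : z + (0 : ℝ) • v = z := by simp
  refine HasFDerivAt.comp_hasDerivAt (l := u) (f := fun s : ℝ => z + s • v) 0 ?_
    (hasDerivAt_segment z v 0)
  rw [h0]
  exact hu.hasFDerivAt

/-- Both sides are derivatives along the line `z + s • v`, where the one-variable product rule
applies. -/
theorem fderiv_rowConnection {z : ℂ} (ht : DifferentiableAt ℝ t z) (hh : DifferentiableAt ℝ h z)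
    (hp : DifferentiableAt ℝ p z) (hk : DifferentiableAt ℝ (wzbar h) z)
    (hA : DifferentiableAt ℝ (rowConnection t h p) z) (v w : ℂ) (x : RowSpace) :
    fderiv ℝ (rowConnection t h p) z v w x =
      (conj (fderiv ℝ h z v * w) * conj x.1,
        conj (fderiv ℝ p z v * w + (fderiv ℝ h z v * conj (h z) + h z * conj (fderiv ℝ h z v))
          * conj w) * conj x.1
          + (fderiv ℝ (wzbar h) z v * w + conj (fderiv ℝ (wzbar h) z v * w)) * x.1
          - conj (fderiv ℝ h z v * w) * conj x.2.1,
        (x.1 * fderiv ℝ t z v * w).re) := by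
  have hl := ((hasDerivAt_line hA v).clm_apply (hasDerivAt_const 0 w)).clm_apply
    (hasDerivAt_const 0 x)
  simp only [map_zero, add_zero, rowConnection, rowBilin_apply] at hl
  have dh := hasDerivAt_line hh v
  have dk := hasDerivAt_line hk v
  have dp := hasDerivAt_line hp v
  have dt := hasDerivAt_line ht v
  have dhw := (dh.mul_const w).star
  have dkw := dk.mul_const w
  have h0 : z + (0 : ℝ) • v = z := by simp
  have d1 := (dhw.mul_const (conj x.1)).add_const (w * conj x.2.1)
  have d2 := ((((dp.mul_const w).add ((dh.mul dh.star).mul_const (conj w))).star.mul_const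
    (conj x.1)).add ((dkw.add dkw.star).mul_const x.1)).sub (dhw.mul_const (conj x.2.1))
  have d3 := Complex.reCLM.hasFDerivAt.comp_hasDerivAt (0 : ℝ) ((dt.const_mul x.1).mul_const w)
  have key := hl.unique (d1.prodMk (d2.prodMk d3))
  rw [h0] at key
  exact key

/-- The `a`-component of the curvature vanishes identically, by the choice of the coefficients of
`db`. The `b`-component vanishes by the equations for `p` and `h`, the `f`-component by the equation
for `t`. -/
theorem isFlat_rowConnection (hU : IsOpen U) (ht : ContDiffOn ℝ ∞ t U) (hh : ContDiffOn ℝ ∞ h U)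
    (hp : ContDiffOn ℝ ∞ p U) (hint : IntegrabilityEquations U t h p) :
    IsFlat (rowConnection t h p) U := by
  intro z hz v w x
  have hdiff : ∀ {F : Type} [NormedAddCommGroup F] [NormedSpace ℝ F] {u : ℂ → F},
      ContDiffOn ℝ ∞ u U → ∀ q ∈ U, DifferentiableAt ℝ u q := fun hu q hq =>
    (hu.differentiableOn (by simp)).differentiableAt (hU.mem_nhds hq)
  have hk := contDiffOn_wzbar hU hh
  have hwc : wz (conjFun h) z = conj (wzbar h z) := wz_conjFun (hdiff hh z hz)
  have hwcc : wz (wz (conjFun h)) z = conj (wzbar (wzbar h) z) := by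
    rw [← wz_conjFun (hdiff hk z hz)]
    refine wz_congr ?_
    filter_upwards [hU.mem_nhds hz] with q hq
    exact wz_conjFun (hdiff hh q hq)
  have e1 := hint.t_eq z hz
  have e2 := hint.p_eq z hz
  have e3 := hint.h_eq z hz
  rw [hwc, wz_normSq (hdiff hh z hz)] at e2
  rw [hwcc] at e3
  have e1' := congrArg conj e1
  have e2' := congrArg conj e2
  simp only [conjFun] at e1 e1' e3
  have hfd : ∀ v w x, _ := fderiv_rowConnection (hdiff ht z hz) (hdiff hh z hz) (hdiff hp z hz)
    (hdiff hk z hz) (hdiff (contDiffOn_rowConnection hU ht hh hp) z hz)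
  rw [hfd, hfd]
  simp only [rowConnection, rowBilin_apply, rowUpper, rowLower, rowPoint, fderiv_eq_wz_add_wzbar]
  simp only [map_add, map_sub, map_mul, Complex.conj_conj, map_ofNat] at e1 e2 e3 e1' e2' ⊢
  -- From here the functions and their Wirtinger derivatives are independent complex numbers, and
  -- the claim is a polynomial identity in them and their conjugates.
  generalize t z = T at *
  generalize h z = H at *
  generalize p z = P at *
  generalize wz t z = tz at *
  generalize wzbar t z = tb at *
  generalize wz h z = hz at *
  generalize wz p z = pz at *
  generalize wzbar p z = pb at *
  generalize wz (wzbar h) z = kz at *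
  generalize wzbar (wzbar h) z = kb at *
  generalize wzbar h z = k at *
  obtain ⟨a, b, f⟩ := x
  refine Prod.ext ?_ (Prod.ext ?_ ?_)
  · simp
    ring
  · simp
    linear_combination (conj a * (v * conj w - w * conj v)) * e2' -
      (a * (w * conj v - v * conj w)) * e3
  · simp only [Prod.snd_add]
    rw [← Complex.add_re, ← Complex.add_re]
    apply Complex.ofReal_injective
    rw [Complex.re_eq_add_conj, Complex.re_eq_add_conj]
    simp
    linear_combination (a * (conj v * w - conj w * v)) * e1
      + (conj a * (v * conj w - w * conj v)) * e1'

/-! ### Rows of frames -/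

/-- The upper half of a row, as a complex number. -/
def upper (M : Mat4) (k : Fin 2 ⊕ Fin 2) : ℂ := ⟨M k (Sum.inl 0), M k (Sum.inl 1)⟩

/-- The lower half of a row, as a complex number. -/
def lower (M : Mat4) (k : Fin 2 ⊕ Fin 2) : ℂ := ⟨M k (Sum.inr 0), M k (Sum.inr 1)⟩

/-- The state of the `k`-th row of a frame field. -/
def rowState (S : ℂ → AffSp) (k : Fin 2 ⊕ Fin 2) (z : ℂ) : RowSpace :=
  (upper (S z).X k, lower (S z).X k, (S z).P k)

/-- The value of the Maurer-Cartan form of a frame with `α` and `γ` symmetric and trace-free. -/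
def mcMatrix (η κ ρ : ℂ) (σ : ℝ) : Mat4 :=
  Matrix.fromBlocks !![η.re, -η.im; -η.im, -η.re] !![ρ.re + σ, -ρ.im; -ρ.im, σ - ρ.re]
    !![κ.re, κ.im; κ.im, -κ.re] !![-η.re, η.im; η.im, η.re]

/-- On `ℝ² = ℂ` a symmetric trace-free block acts as conjugation followed by a complex
multiplication, and a scalar block as a real multiplication. -/
theorem upper_mul_mcMatrix (M : Mat4) (k) (η κ ρ : ℂ) (σ : ℝ) :
    upper (M * mcMatrix η κ ρ σ) k = conj η * conj (upper M k) + κ * conj (lower M k) := by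
  apply Complex.ext <;>
    simp [upper, lower, mcMatrix, Matrix.mul_apply, Fintype.sum_sum_type] <;> ring

theorem lower_mul_mcMatrix (M : Mat4) (k) (η κ ρ : ℂ) (σ : ℝ) :
    lower (M * mcMatrix η κ ρ σ) k =
      conj ρ * conj (upper M k) + σ * upper M k - conj η * conj (lower M k) := by
  apply Complex.ext <;>
    simp [upper, lower, mcMatrix, Matrix.mul_apply, Fintype.sum_sum_type] <;> ring

theorem det_ne_zero (X : Sp4) : IsUnit (X : Mat4).det := SymplecticGroup.symplectic_det X.2

theorem dMat_eq (X : ℂ → Sp4) (q w : ℂ) : dMat X q w = (X q : Mat4) * theta X q w := by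
  rw [theta, ← Matrix.mul_assoc, Matrix.mul_nonsing_inv _ (det_ne_zero _), Matrix.one_mul]

theorem hasFDerivAt_complexMk {f g : ℂ → ℝ} {f' g' : ℂ →L[ℝ] ℝ} {z : ℂ} (hf : HasFDerivAt f f' z)
    (hg : HasFDerivAt g g' z) : HasFDerivAt (fun z => (⟨f z, g z⟩ : ℂ))
      ((Complex.equivRealProdCLM.symm : ℝ × ℝ →L[ℝ] ℂ).comp (f'.prod g')) z :=
  (Complex.equivRealProdCLM.symm : ℝ × ℝ →L[ℝ] ℂ).hasFDerivAt.comp z (hf.prodMk hg)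

theorem SmoothSp.differentiableAt {X : ℂ → Sp4} (hX : SmoothSp U X) (hU : IsOpen U) {q : ℂ}
    (hq : q ∈ U) (i j) : DifferentiableAt ℝ (fun z => (X z : Mat4) i j) q :=
  ((hX i j).differentiableOn (by simp)).differentiableAt (hU.mem_nhds hq)

/-- The differentials of the halves of the rows. -/
theorem hasFDerivAt_upper_lower {X : ℂ → Sp4} (hX : SmoothSp U X) (hU : IsOpen U) {q : ℂ}
    (hq : q ∈ U) (k) : ∃ L L' : ℂ →L[ℝ] ℂ,
      HasFDerivAt (fun z => upper (X z) k) L q ∧ HasFDerivAt (fun z => lower (X z) k) L' q ∧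
      (∀ w, L w = upper ((X q : Mat4) * theta X q w) k) ∧
      (∀ w, L' w = lower ((X q : Mat4) * theta X q w) k) := by
  have hd : ∀ j, HasFDerivAt (fun z => (X z : Mat4) k j) _ q := fun j =>
    (hX.differentiableAt hU hq k j).hasFDerivAt
  refine ⟨_, _, hasFDerivAt_complexMk (hd _) (hd _), hasFDerivAt_complexMk (hd _) (hd _),
    fun w => ?_, fun w => ?_⟩ <;> rw [← dMat_eq] <;> rfl

/-- Frames with the given Maurer-Cartan form have parallel rows. -/
theorem isParallel_rowState (hU : IsOpen U) {S : ℂ → AffSp}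
    (hP : ContDiffOn ℝ ∞ (fun z => (S z).P) U) (hX : SmoothSp U fun z => (S z).X)
    (hmc : ∀ q ∈ U, ∀ w, theta (fun z => (S z).X) q w =
      mcMatrix (h q * w) w (p q * w + h q * conj (h q) * conj w) (2 * (wzbar h q * w).re))
    (hdP : ∀ q ∈ U, ∀ w k, fderiv ℝ (fun z => (S z).P) q w k = (upper (S q).X k * t q * w).re)
    (k) : IsParallel (rowConnection t h p) U (rowState S k) := by
  intro q hq
  obtain ⟨L, L', hL, hL', e, e'⟩ := hasFDerivAt_upper_lower hX hU hq k
  have hPd : HasFDerivAt (fun z => (S z).P k) _ q :=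
    hasFDerivAt_pi'.mp ((hP.differentiableOn (by simp)).differentiableAt
      (hU.mem_nhds hq)).hasFDerivAt k
  refine (hL.prodMk (hL'.prodMk hPd)).congr_fderiv ?_
  ext1 w
  have hs : ((2 * (wzbar h q * w).re : ℝ) : ℂ) = wzbar h q * w + conj (wzbar h q * w) := by
    rw [Complex.add_conj]
  change (L w, L' w, fderiv ℝ (fun z => (S z).P) q w k) = rowBilin _ _ _ _ w (rowState S k q)
  rw [e, e', hmc q hq, upper_mul_mcMatrix, lower_mul_mcMatrix, hdP q hq, hs]
  rfl

/-! ### The Maurer-Cartan form of an adapted frame -/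

theorem hasFDerivAt_matrix_mul {A B : ℂ → Mat4} {A' B' : ℂ → Mat4} {q : ℂ}
    {a b : (Fin 2 ⊕ Fin 2) → (Fin 2 ⊕ Fin 2) → ℂ →L[ℝ] ℝ}
    (hA : ∀ i j, HasFDerivAt (fun z => A z i j) (a i j) q)
    (hB : ∀ i j, HasFDerivAt (fun z => B z i j) (b i j) q)
    (ha : ∀ i j w, a i j w = A' w i j) (hb : ∀ i j w, b i j w = B' w i j) (i j) (w : ℂ) :
    fderiv ℝ (fun z => (A z * B z) i j) q w = (A q * B' w + A' w * B q) i j := by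
  have := HasFDerivAt.fun_sum (u := Finset.univ) fun k _ => (hA i k).mul (hB k j)
  simp only [Matrix.mul_apply]
  refine (congrArg (fun L : ℂ →L[ℝ] ℝ => L w) this.fderiv).trans ?_
  simp [Matrix.mul_apply, Finset.sum_add_distrib, ha, hb, mul_comm]

/-- The Maurer-Cartan form takes values in the symplectic Lie algebra. -/
theorem theta_mem_lieAlgebra {X : ℂ → Sp4} (hX : SmoothSp U X) (hU : IsOpen U) {q : ℂ}
    (hq : q ∈ U) (w : ℂ) :
    Matrix.J (Fin 2) ℝ * theta X q w + (theta X q w)ᵀ * Matrix.J (Fin 2) ℝ = 0 := by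
  have hd : ∀ i j, HasFDerivAt (fun z => (X z : Mat4) i j) _ q := fun i j =>
    (hX.differentiableAt hU hq i j).hasFDerivAt
  have hdT : ∀ i j, HasFDerivAt (fun z => ((X z : Mat4)ᵀ * Matrix.J (Fin 2) ℝ) i j)
      (∑ k, Matrix.J (Fin 2) ℝ k j • fderiv ℝ (fun z => (X z : Mat4) k i) q) q := fun i j => by
    have := HasFDerivAt.fun_sum (u := Finset.univ) fun k _ =>
      (hd k i).mul_const (Matrix.J (Fin 2) ℝ k j)
    simpa only [Matrix.mul_apply, Matrix.transpose_apply] using this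
  have key := hasFDerivAt_matrix_mul hdT hd (A' := fun w => (dMat X q w)ᵀ * Matrix.J (Fin 2) ℝ)
    (B' := fun w => dMat X q w) (fun i j w => by
      simp [Matrix.mul_apply, dMat, mul_comm]) (fun i j w => rfl)
  have h0 : (X q : Mat4)ᵀ * Matrix.J (Fin 2) ℝ * dMat X q w
      + (dMat X q w)ᵀ * Matrix.J (Fin 2) ℝ * (X q : Mat4) = 0 := by
    ext i j
    rw [← key]
    have hc : (fun z => ((X z : Mat4)ᵀ * Matrix.J (Fin 2) ℝ * (X z : Mat4)) i j)
        = fun _ => Matrix.J (Fin 2) ℝ i j := by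
      funext z
      rw [SymplecticGroup.mem_iff'.mp (X z).2]
    rw [hc]
    simp
  have hs := SymplecticGroup.mem_iff'.mp (X q).2
  rw [dMat_eq, Matrix.transpose_mul, ← Matrix.mul_assoc, hs, Matrix.mul_assoc, Matrix.mul_assoc,
    ← Matrix.mul_assoc (X q : Mat4)ᵀ, hs] at h0
  exact h0

theorem theta_blocks {X : ℂ → Sp4} (hX : SmoothSp U X) (hU : IsOpen U) {q : ℂ}
    (hq : q ∈ U) (w : ℂ) :
    gamma X q w 0 1 = gamma X q w 1 0 ∧ beta X q w 0 1 = beta X q w 1 0 ∧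
      ∀ i j, theta X q w (Sum.inr i) (Sum.inr j) = - alpha X q w j i := by
  have h0 := theta_mem_lieAlgebra hX hU hq w
  have he := fun i j => congrFun (congrFun h0 i) j
  simp only [Matrix.add_apply, Matrix.mul_apply, Matrix.transpose_apply, Fintype.sum_sum_type,
    Matrix.zero_apply, Matrix.J] at he
  refine ⟨?_, ?_, fun i j => ?_⟩
  · have := he (Sum.inl 0) (Sum.inl 1)
    simp [Matrix.one_apply] at this
    simp only [gamma, Matrix.toBlocks₂₁, Matrix.of_apply]
    linarith
  · have := he (Sum.inr 0) (Sum.inr 1)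
    simp [Matrix.one_apply] at this
    simp only [beta, Matrix.toBlocks₁₂, Matrix.of_apply]
    linarith
  · have := he (Sum.inl i) (Sum.inr j)
    simp [Matrix.one_apply] at this
    simp only [alpha, Matrix.toBlocks₁₁, Matrix.of_apply]
    linarith

/-- The Lie algebra of `Sp(4, ℝ)` makes `β` and `γ` symmetric. The adaptation conditions remove the
trace of `γ` and the trace and skew part of `α`, and set `ω = dz`, so only `η`, `ρ` and the trace of
`β` remain. -/
theorem theta_eq_mcMatrix (hU : IsOpen U) {f : ℂ → R4} {S : ℂ → AffSp} (hS : IsAdapted U f S)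
    {q : ℂ} (hq : q ∈ U) (w : ℂ) : theta (fun z => (S z).X) q w =
      mcMatrix (etaForm S q w) w (rhoForm S q w)
        ((beta (fun z => (S z).X) q w 0 0 + beta (fun z => (S z).X) q w 1 1) / 2) := by
  obtain ⟨⟨⟨⟨hF, -⟩, h2⟩, -⟩, had⟩ := hS
  obtain ⟨b1, b2, b3⟩ := theta_blocks hF.smooth_linear hU hq w
  obtain ⟨hω, ha1, ha2⟩ := had q hq w
  have hγ := h2 q hq w
  have hre := congrArg Complex.re hω
  have him := congrArg Complex.im hω
  simp only [omegaForm, etaForm, rhoForm] at *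
  generalize (fun z => (S z).X) = X at *
  simp at hre him
  simp only [gamma, beta, alpha, Matrix.toBlocks₁₁, Matrix.toBlocks₁₂, Matrix.toBlocks₂₁,
    Matrix.of_apply] at *
  ext i j
  rcases i with i | i <;> rcases j with j | j <;> fin_cases i <;> fin_cases j <;>
    simp [mcMatrix, b3] <;> linarith

/-- The inverse of a symplectic matrix is `-J Xᵀ J`, so its entries are linear in those of `X`. -/
theorem contDiffOn_inv_entry {X : ℂ → Sp4} (hX : SmoothSp U X) (i j) :
    ContDiffOn ℝ ∞ (fun z => (X z : Mat4)⁻¹ i j) U := by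
  simp only [← SymplecticGroup.coe_inv', SymplecticGroup.coe_inv, Matrix.mul_apply,
    Matrix.transpose_apply]
  exact ContDiffOn.sum fun k _ => (ContDiffOn.sum fun l _ =>
    contDiffOn_const.mul (hX _ _)).mul contDiffOn_const

theorem contDiffOn_ofReal {g : ℂ → ℝ} (hg : ContDiffOn ℝ ∞ g U) :
    ContDiffOn ℝ ∞ (fun z => (g z : ℂ)) U :=
  Complex.ofRealCLM.contDiff.comp_contDiffOn hg

theorem contDiffOn_theta {X : ℂ → Sp4} (hX : SmoothSp U X) (hU : IsOpen U) (w : ℂ) (i j) :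
    ContDiffOn ℝ ∞ (fun z => theta X z w i j) U := by
  simp only [theta, Matrix.mul_apply]
  exact ContDiffOn.sum fun k _ => (contDiffOn_inv_entry hX _ _).mul (contDiffOn_fderiv_apply hU (hX _ _) w)

/-- Having a given `h` as invariant is a pointwise condition; differentiating the structure
equations requires `h` to be smooth. -/
theorem contDiffOn_of_etaForm {S : ℂ → AffSp} (hX : SmoothSp U fun z => (S z).X)
    (hU : IsOpen U) (hη : ∀ q ∈ U, ∀ w, etaForm S q w = h q * w) : ContDiffOn ℝ ∞ h U := by
  have hθ := contDiffOn_theta hX hU 1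
  refine ContDiffOn.congr (f := fun z => etaForm S z 1) ?_ fun q hq => by rw [hη q hq, mul_one]
  exact (contDiffOn_ofReal (((hθ _ _).sub (hθ _ _)).div_const _)).sub
    (contDiffOn_const.mul (contDiffOn_ofReal (((hθ _ _).add (hθ _ _)).div_const _)))

theorem contDiffOn_upper {X : ℂ → Sp4} (hX : SmoothSp U X) (k) :
    ContDiffOn ℝ ∞ (fun z => upper (X z) k) U :=
  (Complex.equivRealProdCLM.symm : ℝ × ℝ →L[ℝ] ℂ).contDiff.comp_contDiffOn
    ((hX k (Sum.inl 0)).prodMk (hX k (Sum.inl 1)))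

/-- The upper halves of the rows of a symplectic matrix span `ℂ` over `ℝ`. -/
theorem eq_zero_of_forall_re_upper {X : Sp4} {c : ℂ} (hc : ∀ k, (upper X k * c).re = 0) :
    c = 0 := by
  -- The real part of `upper X k * c` is the `k`-th entry of this product.
  have h0 : (X : Mat4) *ᵥ (Sum.elim ![c.re, -c.im] 0) = 0 := by
    ext k
    have := hc k
    simp [upper] at this
    simp [Matrix.mulVec, dotProduct, Fintype.sum_sum_type]
    linarith
  have h1 := Matrix.eq_zero_of_mulVec_eq_zero (det_ne_zero X).ne_zero h0
  have hre := congrFun h1 (Sum.inl 0)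
  have him := congrFun h1 (Sum.inl 1)
  simp at hre him
  exact Complex.ext hre him

/-- The real and imaginary parts of `c u + d conj u` are those of `(c + conj d) u` and `(c - conj d)
u` respectively, which reduces the claim to the real case. -/
theorem eq_zero_of_forall_upper {X : Sp4} {c d : ℂ}
    (hc : ∀ k, c * upper X k + d * conj (upper X k) = 0) : c = 0 ∧ d = 0 := by
  have h1 : c + conj d = 0 := eq_zero_of_forall_re_upper (X := X) fun k => by
    have := congrArg Complex.re (hc k)
    simp at this ⊢
    linarith
  have h2 : Complex.I * (c - conj d) = 0 := eq_zero_of_forall_re_upper (X := X) fun k => by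
    have := congrArg Complex.im (hc k)
    simp at this ⊢
    linarith
  have h3 : c - conj d = 0 := by simpa using h2
  have h4 : c = 0 := by linear_combination (h1 + h3) / 2
  exact ⟨h4, by simpa [h4] using h1⟩

theorem theta_eq_add (X : ℂ → Sp4) (q w : ℂ) :
    theta X q w = w.re • theta X q 1 + w.im • theta X q Complex.I := by
  have : dMat X q w = w.re • dMat X q 1 + w.im • dMat X q Complex.I := by
    ext i j
    have hw : w = w.re • (1 : ℂ) + w.im • Complex.I := by simp [Complex.re_add_im]
    have := congrArg (fderiv ℝ (fun z => (X z : Mat4) i j) q) hw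
    rw [map_add, map_smul, map_smul] at this
    exact this
  simp only [theta]
  rw [this, Matrix.mul_add, Matrix.mul_smul, Matrix.mul_smul]

/-- The symmetry of the second derivative of the upper half of a row. -/
theorem second_derivative_upper (hU : IsOpen U) {X : ℂ → Sp4} (hX : SmoothSp U X)
    (hh : ContDiffOn ℝ ∞ h U) {ρ : ℂ → ℂ → ℂ} {σ : ℂ → ℂ → ℝ}
    (hmc : ∀ q ∈ U, ∀ w, theta X q w = mcMatrix (h q * w) w (ρ q w) (σ q w)) {q : ℂ} (hq : q ∈ U)
    (k) (v w : ℂ) :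
    conj (fderiv ℝ h q v * w) * conj (upper (X q) k) +
      w * (ρ q v * upper (X q) k + σ q v * conj (upper (X q) k)) +
      conj (h q) * conj w * h q * v * upper (X q) k =
    conj (fderiv ℝ h q w * v) * conj (upper (X q) k) +
      v * (ρ q w * upper (X q) k + σ q w * conj (upper (X q) k)) +
      conj (h q) * conj v * h q * w * upper (X q) k := by
  have ha := contDiffOn_upper hX k
  have hfd : ∀ z ∈ U, ∀ w, fderiv ℝ (fun z => upper (X z) k) z w =
      conj (h z * w) * conj (upper (X z) k) + w * conj (lower (X z) k) := fun z hz w => by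
    obtain ⟨L, L', hL, -, e, -⟩ := hasFDerivAt_upper_lower hX hU hz k
    rw [hL.fderiv, e, hmc z hz, upper_mul_mcMatrix]
  have hsnd : ∀ v w, fderiv ℝ (fderiv ℝ fun z => upper (X z) k) q v w =
      conj (fderiv ℝ h q v * w) * conj (upper (X q) k)
      + conj (h q * w) * conj (conj (h q * v) * conj (upper (X q) k) + v * conj (lower (X q) k))
      + w * conj (conj (ρ q v) * conj (upper (X q) k) + σ q v * upper (X q) k
          - conj (h q * v) * conj (lower (X q) k)) := by
    intro v w
    have hd2 : DifferentiableAt ℝ (fderiv ℝ fun z => upper (X z) k) q :=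
      ((((contDiffOn_infty_iff_fderiv_of_isOpen hU).mp ha).2).differentiableOn
        (by simp)).differentiableAt (hU.mem_nhds hq)
    have hev : (fun z => fderiv ℝ (fun z => upper (X z) k) z w) =ᶠ[𝓝 q]
        fun z => conj (h z * w) * conj (upper (X z) k) + w * conj (lower (X z) k) := by
      filter_upwards [hU.mem_nhds hq] with z hz using hfd z hz w
    obtain ⟨L, L', hL, hL', e, e'⟩ := hasFDerivAt_upper_lower hX hU hq k
    have l1 := hasDerivAt_line (((hd2.hasFDerivAt.clm_apply
      (hasFDerivAt_const w q)).congr_of_eventuallyEq hev.symm).differentiableAt) v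
    have dh := hasDerivAt_line ((hh.differentiableOn (by simp)).differentiableAt
      (hU.mem_nhds hq)) v
    have da := hasDerivAt_line hL.differentiableAt v
    have db := hasDerivAt_line hL'.differentiableAt v
    have key := l1.unique ((((dh.mul_const w).star).mul da.star).add (db.star.const_mul w))
    rw [← hev.fderiv_eq, fderiv_clm_apply hd2 (differentiableAt_const w)] at key
    have h0 : q + (0 : ℝ) • v = q := by simp
    rw [h0, hL.fderiv, hL'.fderiv, e, e', hmc q hq, upper_mul_mcMatrix, lower_mul_mcMatrix] at key
    simp at key
    rw [key]
    simp
  -- The terms of `hsnd` that contain `lower` are symmetric in `v` and `w`, so the symmetry becomes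
  -- a relation in `upper` alone.
  have hsymm := (ha.contDiffAt (hU.mem_nhds hq)).isSymmSndFDerivAt
    (by
      rw [minSmoothness_of_isRCLikeNormedField]
      exact WithTop.coe_le_coe.mpr (le_top : (2 : ℕ∞) ≤ ⊤)) v w
  rw [hsnd, hsnd] at hsymm
  simp only [map_add, map_sub, map_mul, Complex.conj_conj, Complex.conj_ofReal] at hsymm ⊢
  linear_combination hsymm

/-- The form `β` of an adapted frame is determined by the invariant functions. -/
theorem beta_eq (hU : IsOpen U) {f : ℂ → R4} {S : ℂ → AffSp} (hS : IsAdapted U f S)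
    (hI : HasInvariants U S t h p) {q : ℂ} (hq : q ∈ U) (w : ℂ) :
    rhoForm S q w = p q * w + h q * conj (h q) * conj w ∧
      (beta (fun z => (S z).X) q w 0 0 + beta (fun z => (S z).X) q w 1 1) / 2 =
        2 * (wzbar h q * w).re := by
  have hX := hS.1.1.1.1.smooth_linear
  have hh : ContDiffOn ℝ ∞ h U := contDiffOn_of_etaForm hX hU fun q hq w => (hI q hq w).2.1
  set σ : ℂ → ℂ → ℝ := fun q w =>
    (beta (fun z => (S z).X) q w 0 0 + beta (fun z => (S z).X) q w 1 1) / 2 with hσ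
  have hmc : ∀ q ∈ U, ∀ w, theta (fun z => (S z).X) q w =
      mcMatrix (h q * w) w (rhoForm S q w) (σ q w) := fun q hq w => by
    rw [theta_eq_mcMatrix hU hS hq, (hI q hq w).2.1]
  have hβ : ∀ w i j, beta (fun z => (S z).X) q w i j =
      w.re * beta (fun z => (S z).X) q 1 i j + w.im * beta (fun z => (S z).X) q Complex.I i j :=
    fun w i j => congrFun (congrFun (theta_eq_add (fun z => (S z).X) q w) (Sum.inl i)) (Sum.inr j)
  have hρlin : ∀ w, rhoForm S q w = w.re * rhoForm S q 1 + w.im * rhoForm S q Complex.I := by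
    intro w
    simp only [rhoForm]
    rw [hβ w 0 0, hβ w 1 1, hβ w 1 0]
    push_cast
    ring
  have hσlin : σ q w = w.re * σ q 1 + w.im * σ q Complex.I := by
    simp only [hσ]
    rw [hβ w 0 0, hβ w 1 1]
    ring
  have hp : (rhoForm S q 1 - Complex.I * rhoForm S q Complex.I) / 2 = p q := by
    simpa [part10] using (hI q hq 1).2.2
  -- Here `c` is the `dz̄`-coefficient of `ρ` minus `|h|²`, and `d` that of `σ` minus `conj (wzbar h
  -- q)`. The symmetry relation on the pair `1, I` is `2 * I` times the required identity.
  obtain ⟨e1, e2⟩ := eq_zero_of_forall_upper (X := (S q).X)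
    (c := (rhoForm S q 1 + Complex.I * rhoForm S q Complex.I) / 2 - h q * conj (h q))
    (d := (σ q 1 + Complex.I * σ q Complex.I) / 2 - conj (wzbar h q)) fun k => by
      have key := second_derivative_upper hU hX hh hmc hq k 1 Complex.I
      simp only [fderiv_eq_wz_add_wzbar, map_add, map_mul, map_one, Complex.conj_I,
        mul_one, one_mul, map_neg] at key
      have hI2 := Complex.I_sq
      generalize upper (S q).X k = a at *
      apply mul_left_cancel₀ (mul_ne_zero two_ne_zero Complex.I_ne_zero)
      linear_combination key + (rhoForm S q Complex.I * a + σ q Complex.I * conj a) * hI2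
  have hw : w = w.re + w.im * Complex.I := (Complex.re_add_im w).symm
  have hw' : conj w = w.re - w.im * Complex.I := by apply Complex.ext <;> simp
  constructor
  · rw [hρlin, hw', ← hp]
    conv_rhs => enter [1, 2]; rw [hw]
    linear_combination (w.im * rhoForm S q Complex.I) * Complex.I_sq
      + (w.re - w.im * Complex.I) * e1
  · change σ q w = _
    rw [hσlin]
    have hre := congrArg Complex.re e2
    have him := congrArg Complex.im e2
    simp at hre him
    simp
    linear_combination 2 * w.re * hre + 2 * w.im * him

/-- The tangent plane is spanned by `X₁, X₂`, so `dP = τ¹ X₁ + τ² X₂`, whose `k`-th coordinate is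
the real part of `upper X k * τ`. -/
theorem fderiv_point (hU : IsOpen U) {f : ℂ → R4} {S : ℂ → AffSp} (hS : IsFirstOrder U f S)
    {q : ℂ} (hq : q ∈ U) (hτ : ∀ w, tauForm S q w = t q * w) (w : ℂ) (k) :
    fderiv ℝ (fun z => (S z).P) q w k = (upper (S q).X k * t q * w).re := by
  obtain ⟨hF, hf, hg⟩ := hS
  have hev : (fun z => (S z).P) =ᶠ[𝓝 q] f := by
    filter_upwards [hU.mem_nhds hq] with z hz using hF.along z hz
  have hdet := det_ne_zero (S q).X
  obtain ⟨A, hA, hBA⟩ := Quotient.exact (hg ⟨q, hq⟩)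
  change firstTwo (S q).X = tangentBasis f q * A at hBA
  have hT : tangentBasis f q = firstTwo (S q).X * A⁻¹ := by
    rw [hBA, Matrix.mul_assoc, Matrix.mul_nonsing_inv A (isUnit_iff_ne_zero.mpr hA.ne'),
      Matrix.mul_one]
  have hlow0 : ∀ i j, (((S q).X : Mat4)⁻¹ * tangentBasis f q) (Sum.inr i) j = 0 := by
    intro i j
    have h1 : ((S q).X : Mat4)⁻¹ * firstTwo (S q).X = (1 : Mat4).submatrix id Sum.inl := by
      rw [← Matrix.nonsing_inv_mul _ hdet]
      rfl
    rw [hT, ← Matrix.mul_assoc, h1]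
    simp [Matrix.mul_apply]
  have hlow : ∀ i, tauVec S q w (Sum.inr i) = 0 := by
    intro i
    have hw : w = w.re • (1 : ℂ) + w.im • Complex.I := by simp [Complex.re_add_im]
    have hd : fderiv ℝ f q w = w.re • fderiv ℝ f q 1 + w.im • fderiv ℝ f q Complex.I := by
      have := congrArg (fderiv ℝ f q) hw
      rwa [map_add, map_smul, map_smul] at this
    have h1 : (((S q).X : Mat4)⁻¹ *ᵥ fderiv ℝ f q 1) (Sum.inr i) = 0 := hlow0 i 1
    have h2 : (((S q).X : Mat4)⁻¹ *ᵥ fderiv ℝ f q Complex.I) (Sum.inr i) = 0 := hlow0 i 0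
    rw [tauVec, hev.fderiv_eq, hd, Matrix.mulVec_add, Matrix.mulVec_smul, Matrix.mulVec_smul]
    simp [h1, h2]
  have hP : fderiv ℝ (fun z => (S z).P) q w = ((S q).X : Mat4) *ᵥ tauVec S q w := by
    rw [tauVec, Matrix.mulVec_mulVec, Matrix.mul_nonsing_inv _ hdet, Matrix.one_mulVec]
  rw [hP, mul_assoc, ← hτ, tauForm]
  simp [Matrix.mulVec, dotProduct, Fintype.sum_sum_type, hlow, upper]

/-- The rows of an adapted frame are parallel sections. -/
theorem IsAdapted.isParallel_rowState (hU : IsOpen U) {f : ℂ → R4} {S : ℂ → AffSp}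
    (hS : IsAdapted U f S) (hI : HasInvariants U S t h p) (k) :
    IsParallel (rowConnection t h p) U (rowState S k) := by
  refine AffineSymplectic.isParallel_rowState hU hS.1.1.1.1.smooth_point hS.1.1.1.1.smooth_linear
    (fun q hq w => ?_) (fun q hq w k => fderiv_point hU hS.1.1.1 hq (fun w => (hI q hq w).1) w k) k
  obtain ⟨e1, e2⟩ := beta_eq hU hS hI hq w
  rw [theta_eq_mcMatrix hU hS hq, (hI q hq w).2.1, e1, e2]

/-! ### Uniqueness -/

/-- The invariant functions of a frame field are smooth. -/
theorem HasInvariants.contDiffOn (hU : IsOpen U) {S : ℂ → AffSp}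
    (hP : ContDiffOn ℝ ∞ (fun z => (S z).P) U) (hX : SmoothSp U fun z => (S z).X)
    (hI : HasInvariants U S t h p) :
    ContDiffOn ℝ ∞ t U ∧ ContDiffOn ℝ ∞ h U ∧ ContDiffOn ℝ ∞ p U := by
  refine ⟨?_, contDiffOn_of_etaForm hX hU fun q hq w => (hI q hq w).2.1, ?_⟩
  · have hτ : ∀ i, ContDiffOn ℝ ∞ (fun z => tauVec S z 1 i) U := fun i => by
      simp only [tauVec, Matrix.mulVec, dotProduct]
      exact ContDiffOn.sum fun k _ => (contDiffOn_inv_entry hX _ _).mul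
        (contDiffOn_pi.mp (contDiffOn_fderiv_apply hU hP 1) k)
    refine ContDiffOn.congr (f := fun z => tauForm S z 1) ?_ fun q hq => by
      rw [(hI q hq 1).1, mul_one]
    exact (contDiffOn_ofReal (hτ _)).sub (contDiffOn_const.mul (contDiffOn_ofReal (hτ _)))
  · have hρ : ∀ w, ContDiffOn ℝ ∞ (fun z => rhoForm S z w) U := fun w => by
      have hθ := contDiffOn_theta hX hU w
      exact (contDiffOn_ofReal (((hθ _ _).sub (hθ _ _)).div_const _)).sub
        (contDiffOn_const.mul (contDiffOn_ofReal (hθ _ _)))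
    refine ContDiffOn.congr
      (f := fun z => (rhoForm S z 1 - Complex.I * rhoForm S z Complex.I) / 2) ?_ fun q hq => by
        have := (hI q hq 1).2.2
        rw [part10, mul_one, mul_one] at this
        exact this.symm
    exact ((hρ 1).sub (contDiffOn_const.mul (hρ Complex.I))).div_const 2

theorem sum_smul_upper (A M : Mat4) (k) : ∑ j, A k j • upper M j = upper (A * M) k := by
  apply Complex.ext <;> simp [upper, Matrix.mul_apply]

theorem sum_smul_lower (A M : Mat4) (k) : ∑ j, A k j • lower M j = lower (A * M) k := by
  apply Complex.ext <;> simp [lower, Matrix.mul_apply]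

/-- The system does not involve the coordinate of the point; this is invariance under translations.
-/
theorem isParallel_const_point (c : ℝ) :
    IsParallel (rowConnection t h p) U fun _ => ((0, 0, c) : RowSpace) := by
  intro z _
  refine (hasFDerivAt_const _ z).congr_fderiv ?_
  ext1 w
  change (0 : RowSpace) = rowBilin _ _ _ _ w (0, 0, c)
  simp [rowUpper, rowLower, rowPoint]
  rfl

/-- Frames whose rows are parallel for the same connection are congruent. -/
theorem exists_congruence (hU : IsOpen U) (hU' : IsPreconnected U) (hne : U.Nonempty)
    {f f' : ℂ → R4} {S S' : ℂ → AffSp} (hS : IsAdapted U f S) (hS' : IsAdapted U f' S')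
    (hI : HasInvariants U S t h p) (hI' : HasInvariants U S' t h p) :
    ∃ g : AffSp, ∀ z ∈ U, f' z = g.act (f z) := by
  obtain ⟨z₀, hz₀⟩ := hne
  obtain ⟨ht, hh, hp⟩ := hI.contDiffOn hU hS.1.1.1.1.smooth_point hS.1.1.1.1.smooth_linear
  have hA := (contDiffOn_rowConnection hU ht hh hp).continuousOn
  set A : Sp4 := (S' z₀).X * (S z₀).X⁻¹ with hAdef
  have hAX : (A : Mat4) * (S z₀).X = (S' z₀).X := by
    have : A * (S z₀).X = (S' z₀).X := by rw [hAdef, inv_mul_cancel_right]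
    rw [← this]
    rfl
  refine ⟨⟨(S' z₀).P - (A : Mat4) *ᵥ (S z₀).P, A⟩, fun z hz => ?_⟩
  ext k
  -- The rows of `A * X` are constant combinations of the rows of `X`, hence parallel; the constant
  -- summand is the translation part.
  have hpar := (IsParallel.sum Finset.univ fun j _ =>
    (hS.isParallel_rowState hU hI j).const_smul ((A : Mat4) k j)).add
    (isParallel_const_point (t := t) (h := h) (p := p) (U := U)
      ((S' z₀).P k - ((A : Mat4) *ᵥ (S z₀).P) k))
  have hsum : ∀ z, ∑ j, (A : Mat4) k j • rowState S j z =
      (upper (A * (S z).X) k, lower (A * (S z).X) k, ((A : Mat4) *ᵥ (S z).P) k) := fun z => by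
    rw [← sum_smul_upper, ← sum_smul_lower]
    refine Prod.ext ?_ (Prod.ext ?_ ?_)
    · simp [rowState]
    · simp [rowState]
    · simp [rowState, Matrix.mulVec, dotProduct]
  simp only [hsum] at hpar
  have := hpar.eqOn (hS'.isParallel_rowState hU hI' k) hU hU' hA hz₀ (by
    simp [rowState, hAX]) hz
  have h3 := congrArg (fun x : RowSpace => x.2.2) this
  simp only [rowState, Prod.snd_add] at h3
  rw [← hS.1.1.1.1.along z hz, ← hS'.1.1.1.1.along z hz, ← h3, AffSp.act]
  simp only [Pi.add_apply, Pi.sub_apply]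
  ring

theorem ext_upper_lower {M N : Mat4} (h₁ : ∀ k, upper M k = upper N k)
    (h₂ : ∀ k, lower M k = lower N k) : M = N := by
  ext k j
  rcases j with j | j <;> fin_cases j
  · exact congrArg Complex.re (h₁ k)
  · exact congrArg Complex.im (h₁ k)
  · exact congrArg Complex.re (h₂ k)
  · exact congrArg Complex.im (h₂ k)

/-- An immersion has at most one adapted frame with given invariant functions. -/
theorem eqOn_of_isAdapted (hU : IsOpen U) (ht : ∀ z ∈ U, t z ≠ 0) {f : ℂ → R4}
    {S S' : ℂ → AffSp} (hS : IsAdapted U f S) (hS' : IsAdapted U f S')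
    (hI : HasInvariants U S t h p) (hI' : HasInvariants U S' t h p) : EqOn S' S U := by
  have hP : ∀ z ∈ U, (S' z).P = (S z).P := fun z hz => by
    rw [hS.1.1.1.1.along z hz, hS'.1.1.1.1.along z hz]
  have hup : ∀ k, ∀ z ∈ U, upper (S' z).X k = upper (S z).X k := by
    intro k q hq
    have hev : (fun z => (S' z).P) =ᶠ[𝓝 q] fun z => (S z).P := by
      filter_upwards [hU.mem_nhds hq] with z hz using hP z hz
    have e : ∀ w, (upper (S' q).X k * t q * w).re = (upper (S q).X k * t q * w).re := fun w => by
      rw [← fderiv_point hU hS.1.1.1 hq (fun w => (hI q hq w).1) w k,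
        ← fderiv_point hU hS'.1.1.1 hq (fun w => (hI' q hq w).1) w k, hev.fderiv_eq]
    have e1 := e 1
    have e2 := e Complex.I
    -- The directions `1` and `I` give the real and imaginary parts of `upper X k * t q`.
    refine mul_right_cancel₀ (ht q hq) (Complex.ext ?_ ?_)
    · simpa using e1
    · simp at e2 ⊢
      linarith
  have hlow : ∀ k, ∀ z ∈ U, lower (S' z).X k = lower (S z).X k := by
    intro k q hq
    have hev : (fun z => upper (S' z).X k) =ᶠ[𝓝 q] fun z => upper (S z).X k := by
      filter_upwards [hU.mem_nhds hq] with z hz using hup k z hz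
    have d := (hS.isParallel_rowState hU hI k q hq).fst
    have d' := (hS'.isParallel_rowState hU hI' k q hq).fst
    -- In direction `1` the equation is `da = conj h conj a + conj b`, so `a` and `da` determine
    -- `b`.
    have := congrArg (fun L : ℂ →L[ℝ] ℂ => L 1) (d.unique (d'.congr_of_eventuallyEq hev.symm))
    simp [rowConnection, rowState, rowUpper, hup k q hq] at this
    exact star_injective this.symm
  intro z hz
  refine AffSp.ext (hP z hz) (Subtype.ext ?_)
  exact ext_upper_lower (fun k => hup k z hz) fun k => hlow k z hz

/-! ### Existence -/

/-- A field of affine symplectic frames all of whose rows are parallel. -/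
def HasParallelRows (U : Set ℂ) (S : ℂ → AffSp) (t h p : ℂ → ℂ) : Prop :=
  ∀ k, IsParallel (rowConnection t h p) U (rowState S k)

namespace HasParallelRows

variable {S : ℂ → AffSp}

theorem contDiffOn_rowState (hS : HasParallelRows U S t h p) (hU : IsOpen U)
    (hA : ContDiffOn ℝ ∞ (rowConnection t h p) U) (k) : ContDiffOn ℝ ∞ (rowState S k) U :=
  (hS k).contDiffOn hU hA

theorem smoothSp (hS : HasParallelRows U S t h p) (hU : IsOpen U)
    (hA : ContDiffOn ℝ ∞ (rowConnection t h p) U) : SmoothSp U fun z => (S z).X := by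
  intro k j
  have hk := hS.contDiffOn_rowState hU hA k
  rcases j with j | j <;> fin_cases j
  · exact Complex.reCLM.contDiff.comp_contDiffOn hk.fst
  · exact Complex.imCLM.contDiff.comp_contDiffOn hk.fst
  · exact Complex.reCLM.contDiff.comp_contDiffOn hk.snd.fst
  · exact Complex.imCLM.contDiff.comp_contDiffOn hk.snd.fst

theorem contDiffOn_point (hS : HasParallelRows U S t h p) (hU : IsOpen U)
    (hA : ContDiffOn ℝ ∞ (rowConnection t h p) U) : ContDiffOn ℝ ∞ (fun z => (S z).P) U :=
  contDiffOn_pi.mpr fun k => (hS.contDiffOn_rowState hU hA k).snd.snd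

theorem theta_eq (hS : HasParallelRows U S t h p) (hU : IsOpen U)
    (hA : ContDiffOn ℝ ∞ (rowConnection t h p) U) {q : ℂ} (hq : q ∈ U) (w : ℂ) :
    theta (fun z => (S z).X) q w =
      mcMatrix (h q * w) w (p q * w + h q * conj (h q) * conj w) (2 * (wzbar h q * w).re) := by
  have hs : ((2 * (wzbar h q * w).re : ℝ) : ℂ) = wzbar h q * w + conj (wzbar h q * w) := by
    rw [Complex.add_conj]
  have key : ((S q).X : Mat4) * theta (fun z => (S z).X) q w = (S q).X *
      mcMatrix (h q * w) w (p q * w + h q * conj (h q) * conj w) (2 * (wzbar h q * w).re) := by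
    refine ext_upper_lower (fun k => ?_) fun k => ?_ <;>
      obtain ⟨L, L', hL, hL', e, e'⟩ := hasFDerivAt_upper_lower (hS.smoothSp hU hA) hU hq k
    · rw [← e w, upper_mul_mcMatrix]
      exact congrArg (fun L : ℂ →L[ℝ] ℂ => L w) (hL.unique (hS k q hq).fst)
    · rw [← e' w, lower_mul_mcMatrix, hs]
      exact congrArg (fun L : ℂ →L[ℝ] ℂ => L w) (hL'.unique (hS k q hq).snd.fst)
  have := congrArg (fun M => ((S q).X : Mat4)⁻¹ * M) key
  simpa only [← Matrix.mul_assoc, Matrix.nonsing_inv_mul _ (det_ne_zero _), Matrix.one_mul]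
    using this

theorem fderiv_point (hS : HasParallelRows U S t h p) {q : ℂ} (hq : q ∈ U) (w : ℂ) :
    fderiv ℝ (fun z => (S z).P) q w =
      ((S q).X : Mat4) *ᵥ Sum.elim ![(t q * w).re, -(t q * w).im] 0 := by
  have hd : HasFDerivAt (fun z => (S z).P) (ContinuousLinearMap.pi fun k => _) q :=
    hasFDerivAt_pi.mpr fun k => (hS k q hq).snd.snd
  rw [hd.fderiv]
  ext k
  change rowPoint (t q) w (upper (S q).X k) = _
  rw [rowPoint, mul_assoc]
  simp [Matrix.mulVec, dotProduct, Fintype.sum_sum_type, upper]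
  ring

end HasParallelRows

theorem Omega_mulVec (X : Sp4) (v w : R4) :
    Omega ((X : Mat4) *ᵥ v) ((X : Mat4) *ᵥ w) = Omega v w := by
  have hJ : stdJ = - Matrix.J (Fin 2) ℝ := by
    simp [stdJ, Matrix.J, Matrix.fromBlocks_neg]
  have hX : (X : Mat4)ᵀ * stdJ * X = stdJ := by
    rw [hJ, Matrix.mul_neg, Matrix.neg_mul, SymplecticGroup.mem_iff'.mp X.2]
  rw [Omega, Omega, ← Matrix.vecMul_transpose, ← Matrix.dotProduct_mulVec, Matrix.mulVec_mulVec,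
    Matrix.mulVec_mulVec, hX]

/-- In the frame, `df(w)` has components `Re (t w), -Im (t w), 0, 0`: injectivity comes from `t ≠
0`, isotropy from the plane of `X₁, X₂`. -/
theorem HasParallelRows.isLagrangianImmersion {S : ℂ → AffSp} (hS : HasParallelRows U S t h p)
    (hU : IsOpen U) (hA : ContDiffOn ℝ ∞ (rowConnection t h p) U) (ht : ∀ z ∈ U, t z ≠ 0) :
    IsLagrangianImmersion U fun z => (S z).P := by
  refine ⟨hS.contDiffOn_point hU hA, fun q hq => ?_, fun q hq v w => ?_⟩
  · rw [injective_iff_map_eq_zero]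
    intro w hw
    rw [hS.fderiv_point hq] at hw
    have h1 := Matrix.eq_zero_of_mulVec_eq_zero (det_ne_zero (S q).X).ne_zero hw
    have hre : (t q * w).re = 0 := congrFun h1 (Sum.inl 0)
    have him : -(t q * w).im = 0 := congrFun h1 (Sum.inl 1)
    have : t q * w = 0 := Complex.ext hre (neg_eq_zero.mp him)
    exact (mul_eq_zero.mp this).resolve_left (ht q hq)
  · rw [hS.fderiv_point hq, hS.fderiv_point hq, Omega_mulVec]
    simp [Omega, stdJ, Matrix.fromBlocks_mulVec, dotProduct, Fintype.sum_sum_type]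

theorem HasParallelRows.gaussMap_eq {S : ℂ → AffSp} (hS : HasParallelRows U S t h p)
    (ht : ∀ z ∈ U, t z ≠ 0) (hf : IsLagrangianImmersion U fun z => (S z).P) (z : U) :
    gaussMap hf z = projLambda (S z).X := by
  -- The columns are the components of `df(∂_y)` and `df(∂_x)` on `X₁, X₂`, namely those of `w = I`
  -- and `w = 1`. This order, which is that of the opposite orientation, makes the determinant
  -- `|t|²` instead of `-|t|²`.
  refine Quotient.sound (lagrangianBasisSetoid.symm ⟨!![-(t z).im, (t z).re; -(t z).re, -(t z).im], ?_, ?_⟩)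
  · rw [Matrix.det_fin_two_of]
    have : 0 < Complex.normSq (t z) := Complex.normSq_pos.mpr (ht z z.2)
    rw [Complex.normSq_apply] at this
    linarith
  · change tangentBasis _ _ = firstTwo _ * _
    ext i j
    rw [tangentBasis, Matrix.of_apply, hS.fderiv_point z.2]
    fin_cases j <;>
      simp [Matrix.mulVec, dotProduct, Fintype.sum_sum_type, firstTwo, Matrix.mul_apply]

/-- Frame fields with parallel rows are adapted and have the given invariant functions. -/
theorem HasParallelRows.isAdapted {S : ℂ → AffSp} (hS : HasParallelRows U S t h p)
    (hU : IsOpen U) (hA : ContDiffOn ℝ ∞ (rowConnection t h p) U) (ht : ∀ z ∈ U, t z ≠ 0) :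
    IsEllipticLagrangianImmersion U (fun z => (S z).P) ∧ IsAdapted U (fun z => (S z).P) S ∧
      HasInvariants U S t h p := by
  have hf := hS.isLagrangianImmersion hU hA ht
  have hg := hS.gaussMap_eq ht hf
  have hX := hS.smoothSp hU hA
  have hθ : ∀ q ∈ U, ∀ w, _ := fun q hq w => hS.theta_eq hU hA hq w
  have hη : ∀ q ∈ U, ∀ w, etaForm S q w = h q * w := fun q hq w => by
    simp only [etaForm, alpha, hθ q hq, mcMatrix, Matrix.toBlocks_fromBlocks₁₁]
    apply Complex.ext <;> simp; ring
  have hω : ∀ q ∈ U, ∀ w, omegaForm S q w = w := fun q hq w => by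
    simp only [omegaForm, gamma, hθ q hq, mcMatrix, Matrix.toBlocks_fromBlocks₂₁]
    apply Complex.ext <;> simp
  have hρ : ∀ q ∈ U, ∀ w, rhoForm S q w = p q * w + h q * conj (h q) * conj w := fun q hq w => by
    simp only [rhoForm, beta, hθ q hq, mcMatrix, Matrix.toBlocks_fromBlocks₁₂]
    apply Complex.ext <;> simp; ring
  have hτ : ∀ q ∈ U, ∀ w, tauForm S q w = t q * w := fun q hq w => by
    simp only [tauForm, tauVec, hS.fderiv_point hq, Matrix.mulVec_mulVec,
      Matrix.nonsing_inv_mul _ (det_ne_zero _), Matrix.one_mulVec]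
    apply Complex.ext <;> simp
  -- The frame itself is a smooth lift of the Gauss map, defined on all of `U`.
  refine ⟨⟨hf, fun q hq => ⟨U, fun z => (S z).X, hU, hq, hX, fun z _ => (hg z).symm,
    fun w hw => ?_, fun w hw => ?_⟩⟩, ⟨⟨⟨⟨⟨hS.contDiffOn_point hU hA, hX, fun _ _ => rfl⟩, hf, hg⟩,
      fun q hq w => ?_⟩, fun q hq => ⟨h q, fun w => by rw [hη q hq, hω q hq]⟩⟩,
      fun q hq w => ⟨hω q hq w, ?_, ?_⟩⟩, fun q hq w => ⟨hτ q hq w, hη q hq w, ?_⟩⟩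
  · rw [← hω q hq w]
    simp [omegaForm, hw]
  -- Since `γ` is trace-free with `ω = dz`, the quadratic form pulls back to `|dz|²`.
  · have : 0 < Complex.normSq w := Complex.normSq_pos.mpr hw
    rw [Complex.normSq_apply] at this
    simp only [gForm, gamma, hθ q hq, mcMatrix, Matrix.toBlocks_fromBlocks₂₁]
    simp
    linarith
  · simp [gamma, hθ q hq, mcMatrix]
  · simp [alpha, hθ q hq, mcMatrix]
  · simp [alpha, hθ q hq, mcMatrix]
  · rw [part10, hρ q hq, hρ q hq, map_one, Complex.conj_I]
    linear_combination (-(p q) * w / 2 + h q * conj (h q) * w / 2) * Complex.I_sq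

/-! ### Symplecticity of the matrix of solutions. -/

/-- The pairing of two parallel rows is constant. -/
theorem fderiv_pairing {u v : ℂ → RowSpace} (hu : IsParallel (rowConnection t h p) U u)
    (hv : IsParallel (rowConnection t h p) U v) {q : ℂ} (hq : q ∈ U) :
    HasFDerivAt (fun z => ((u z).2.1 * conj (v z).1 - (u z).1 * conj (v z).2.1).re)
      (0 : ℂ →L[ℝ] ℝ) q := by
  have hconj : ∀ {g : ℂ → ℂ}, DifferentiableAt ℝ g q → DifferentiableAt ℝ (fun z => conj (g z)) q :=
    fun hg => (Complex.conjCLE : ℂ →L[ℝ] ℂ).differentiableAt.comp q hg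
  have u1 := (hu q hq).fst
  have u2 := (hu q hq).snd.fst
  have v1 := (hv q hq).fst
  have v2 := (hv q hq).snd.fst
  have hd : DifferentiableAt ℝ
      (fun z => ((u z).2.1 * conj (v z).1 - (u z).1 * conj (v z).2.1).re) q :=
    Complex.reCLM.differentiableAt.comp q
      ((u2.differentiableAt.mul (hconj v1.differentiableAt)).sub
        (u1.differentiableAt.mul (hconj v2.differentiableAt)))
  refine hd.hasFDerivAt.congr_fderiv ?_
  ext1 w
  have h0 : q + (0 : ℝ) • w = q := by simp
  have d1 := hasDerivAt_line u1.differentiableAt w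
  have d2 := hasDerivAt_line u2.differentiableAt w
  have d3 := hasDerivAt_line v1.differentiableAt w
  have d4 := hasDerivAt_line v2.differentiableAt w
  have key := (hasDerivAt_line hd w).unique (Complex.reCLM.hasFDerivAt.comp_hasDerivAt (0 : ℝ)
    ((d2.mul d3.star).sub (d1.mul d4.star)))
  rw [key, u1.fderiv, u2.fderiv, v1.fderiv, v2.fderiv, h0]
  simp [rowConnection, rowUpper, rowLower]
  ring

/-- The matrix with given rows. -/
def rowMatrix (u : Fin 2 ⊕ Fin 2 → RowSpace) : Mat4 :=
  Matrix.of fun k => Sum.elim ![(u k).1.re, (u k).1.im] ![(u k).2.1.re, (u k).2.1.im]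

/-- The pairings of the rows are the entries of `M J Mᵀ`; since they are constant for parallel rows,
`M` is symplectic on a connected set once it is so at one point. -/
theorem rowMatrix_mul_J_mul_transpose (u : Fin 2 ⊕ Fin 2 → RowSpace) (k l) :
    (rowMatrix u * Matrix.J (Fin 2) ℝ * (rowMatrix u)ᵀ) k l =
      ((u k).2.1 * conj (u l).1 - (u k).1 * conj (u l).2.1).re := by
  simp [rowMatrix, Matrix.mul_apply, Fintype.sum_sum_type, Matrix.J, Matrix.one_apply]
  ring

/-- Solutions of the linear system of the rows starting at the rows of the identity matrix are the
rows of a field of frames. -/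
theorem exists_hasParallelRows (hU : IsOpen U) (hsc : IsSimplyConnected U)
    (ht : ContDiffOn ℝ ∞ t U) (hh : ContDiffOn ℝ ∞ h U) (hp : ContDiffOn ℝ ∞ p U)
    (hint : IntegrabilityEquations U t h p) : ∃ S, HasParallelRows U S t h p := by
  obtain ⟨z₀, hz₀⟩ := hsc.nonempty
  choose u hu hu₀ using fun k => exists_parallel hU hsc (contDiffOn_rowConnection hU ht hh hp)
    (isFlat_rowConnection hU ht hh hp hint) hz₀ ((upper 1 k, lower 1 k, 0) : RowSpace)
  have h1 : rowMatrix (fun k => u k z₀) = 1 := by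
    refine ext_upper_lower (fun k => ?_) fun k => ?_
    · exact congrArg Prod.fst (hu₀ k)
    · exact congrArg (fun x : RowSpace => x.2.1) (hu₀ k)
  have hsymp : ∀ z ∈ U, rowMatrix (fun k => u k z) ∈ Matrix.symplecticGroup (Fin 2) ℝ := by
    intro z hz
    rw [SymplecticGroup.mem_iff]
    ext k l
    have hc := hU.is_const_of_fderiv_eq_zero hsc.isPathConnected.isConnected.isPreconnected
      (fun q hq => (fderiv_pairing (hu k) (hu l) hq).differentiableAt.differentiableWithinAt)
      (fun q hq => (fderiv_pairing (hu k) (hu l) hq).fderiv) hz hz₀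
    rw [rowMatrix_mul_J_mul_transpose (fun k => u k z), hc,
      ← rowMatrix_mul_J_mul_transpose (fun k => u k z₀), h1]
    simp
  classical
  -- Outside `U` the frame is the identity; since `U` is open, this value does not affect the
  -- derivatives at its points.
  refine ⟨fun z => if hz : z ∈ U then ⟨fun k => (u k z).2.2, ⟨_, hsymp z hz⟩⟩ else ⟨0, 1⟩,
    fun k z hz => ?_⟩
  have hev : ∀ z ∈ U, rowState (fun z => if hz : z ∈ U then
      (⟨fun k => (u k z).2.2, ⟨_, hsymp z hz⟩⟩ : AffSp) else ⟨0, 1⟩) k z = u k z := fun z hz => by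
    simp only [rowState, hz, dite_true]
    rfl
  rw [rowConnection, hev z hz]
  exact (hu k z hz).congr_of_eventuallyEq
    (by filter_upwards [hU.mem_nhds hz] with q hq using hev q hq)

end AffineSymplectic

/-! ### The main theorem. -/

theorem theorem1 (U : Set ℂ) (hU : IsOpen U) (hsc : IsSimplyConnected U) :
    (∀ t h p : ℂ → ℂ,
      ContDiffOn ℝ ∞ t U → ContDiffOn ℝ ∞ h U → ContDiffOn ℝ ∞ p U →
      (∀ z ∈ U, t z ≠ 0) → IntegrabilityEquations U t h p →
      ∃ f : ℂ → R4, IsEllipticLagrangianImmersion U f ∧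
        (∃ S : ℂ → AffSp, IsAdapted U f S ∧ HasInvariants U S t h p ∧
          ∀ S' : ℂ → AffSp, IsAdapted U f S' → HasInvariants U S' t h p → Set.EqOn S' S U) ∧
        (∀ f' : ℂ → R4, IsEllipticLagrangianImmersion U f' →
          (∃ S' : ℂ → AffSp, IsAdapted U f' S' ∧ HasInvariants U S' t h p) →
          ∃ g : AffSp, ∀ z ∈ U, f' z = g.act (f z))) ∧
    (∀ (f f' : ℂ → R4) (S S' : ℂ → AffSp) (t h p : ℂ → ℂ),
      IsEllipticLagrangianImmersion U f → IsEllipticLagrangianImmersion U f' →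
      IsAdapted U f S → IsAdapted U f' S' →
      HasInvariants U S t h p → HasInvariants U S' t h p →
      ∃ g : AffSp, ∀ z ∈ U, f' z = g.act (f z)) := by
  have hconn := hsc.isPathConnected.isConnected
  refine ⟨fun t h p ht hh hp ht0 hint => ?_, fun f f' S S' t h p _ _ hS hS' hI hI' =>
    exists_congruence hU hconn.isPreconnected hconn.nonempty hS hS' hI hI'⟩
  obtain ⟨S, hS⟩ := exists_hasParallelRows hU hsc ht hh hp hint
  obtain ⟨hf, had, hI⟩ := hS.isAdapted hU (contDiffOn_rowConnection hU ht hh hp) ht0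
  exact ⟨_, hf, ⟨S, had, hI, fun S' hS' hI' => eqOn_of_isAdapted hU ht0 had hS' hI hI'⟩,
    fun f' _ ⟨S', hS', hI'⟩ =>
      exists_congruence hU hconn.isPreconnected hconn.nonempty had hS' hI hI'⟩
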